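/- Let $M\subseteq\mathbb{Z}^m$ be an affine monoid, i.e. a finitely generated submonoid of $\mathbb{Z}^m$, and let $K$ be a field. Let $\mathrm{cn}(M)\subseteq\mathbb{R}^m$ be the cone of all linear combinations of elements of $M$ with nonnegative real coefficients. A face of $\mathrm{cn}(M)$ is a set $\{x\in \mathrm{cn}(M):\beta(x)=0\}$ where $\beta$ is a linear form on $\mathbb{R}^m$ that is nonnegative on $\mathrm{cn}(M)$; it is proper if it is different from $\mathrm{cn}(M)$; and $F_1,\dots,F_t$ denote the facets of $\mathrm{cn}(M)$, i.e. its maximal proper faces. Write $\mathrm{gp}(X)$ for the subgroup of $\mathbb{Z}^m$ generated by $X$ and $\mathrm{relint}\,F$ for the interior of $F$ relative to its affine hull. Put $$M_i=\{a\in \mathrm{gp}(M): a+b\in M\text{ for some } b\in M\cap F_i\},\qquad M'=\bigcap_{i=1}^t M_i,$$ with $M'=\mathrm{gp}(M)$ if $t=0$. Recall that a Noetherian ring $R$ satisfies Serre's condition $(S_2)$ if $\operatorname{depth} R_{\mathfrak p}\ge\min\{2,\dim R_{\mathfrak p}\}$ for all primes $\mathfrak p$ of $R$, and that $M$ is called seminormal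 if $z\in \mathrm{gp}(M)$, $2z\in M$ and $3z\in M$ imply $z\in M$. Let $K[M]$ be the monoid algebra of $M$ over $K$. (a) If $\mathrm{gp}(M)\cap \mathrm{relint}\,\mathrm{cn}(M)\subseteq M$, then the following are equivalent: (i) $K[M]$ satisfies $(S_2)$; (ii) $M=M'$; (iii) for every proper face $F$ of $\mathrm{cn}(M)$ one has $M\cap \mathrm{relint}\,F=\bigcap_{F\subseteq F_j}\mathrm{gp}(M\cap F_j)\cap \mathrm{relint}\,F$. (b) If $M$ is seminormal, then $\mathrm{gp}(M)\cap \mathrm{relint}\,\mathrm{cn}(M)\subseteq M$, and (i), (ii), (iii) are also equivalent to (iv) for every proper face $F$ of $\mathrm{cn}(M)$ one has $\mathrm{gp}(M\cap F)=\bigcap_{F\subseteq F_j}\mathrm{gp}(M\cap F_j)$. -/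

import Mathlib

noncomputable section

namespace Serre

open IsLocalRing RingTheory.Sequence

/-- The depth of a module `N` over a local ring `A`: the supremum of the lengths of the
`N`-regular sequences in the maximal ideal. -/
def depth (A N : Type*) [CommRing A] [IsLocalRing A] [AddCommGroup N] [Module A N] : ℕ∞ :=
  ⨆ (rs : List A) (_ : IsRegular N rs) (_ : ∀ r ∈ rs, r ∈ maximalIdeal A), (rs.length : ℕ∞)

/-- Serre's condition `(S_k)` for an `R`-module `N`: for every prime `p` of `R`,
`depth N_p ≥ min {k, dim N_p}`, where the dimension is that of the support
(`⊥` for the zero module). -/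
def SatisfiesS (k : ℕ) (R N : Type*) [CommRing R] [AddCommGroup N] [Module R N] : Prop :=
  ∀ (p : Ideal R) [p.IsPrime],
    min (((k : ℕ∞)) : WithBot ℕ∞)
        (Module.supportDim (Localization.AtPrime p) (LocalizedModule.AtPrime p N))
      ≤ ((depth (Localization.AtPrime p) (LocalizedModule.AtPrime p N) : ℕ∞) : WithBot ℕ∞)

end Serre

namespace AffineMonoid

variable {m : ℕ}

/-- The embedding of `ℤ^m` into `ℝ^m`. -/
def toReal (a : Fin m → ℤ) : Fin m → ℝ := fun i => (a i : ℝ)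

/-- `cn(M)`, the set of linear combinations with nonnegative real coefficients of
elements of `M`. -/
def cn (M : AddSubmonoid (Fin m → ℤ)) : Set (Fin m → ℝ) :=
  (PointedCone.hull ℝ (toReal '' (M : Set (Fin m → ℤ))) : Set (Fin m → ℝ))

/-- Faces of a cone `C`: the intersections of `C` with a hyperplane `β = 0` such that `β ≥ 0`
on `C`, and (for `β = 0`) the cone `C` itself. Linear forms suffice, since an affine form that is
nonnegative on a cone and has a zero on it has constant term `0`. The empty set is not a face. -/
def IsFace (C F : Set (Fin m → ℝ)) : Prop :=
  ∃ β : (Fin m → ℝ) →ₗ[ℝ] ℝ, (∀ x ∈ C, 0 ≤ β x) ∧ F = {x ∈ C | β x = 0}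

def IsProperFace (C F : Set (Fin m → ℝ)) : Prop := IsFace C F ∧ F ≠ C

/-- A facet is a maximal proper face. -/
def IsFacet (C F : Set (Fin m → ℝ)) : Prop := Maximal (IsProperFace C) F

/-- The relative interior of `F` in its affine hull. -/
abbrev relint (F : Set (Fin m → ℝ)) : Set (Fin m → ℝ) := intrinsicInterior ℝ F

/-- `gp(M)`, the subgroup of `ℤ^m` generated by `M`. -/
def gp (M : AddSubmonoid (Fin m → ℤ)) : AddSubgroup (Fin m → ℤ) :=
  AddSubgroup.closure (M : Set (Fin m → ℤ))

/-- `gp(M ∩ F)`, the subgroup of `ℤ^m` generated by `M ∩ F`. -/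
def gpInter (M : AddSubmonoid (Fin m → ℤ)) (F : Set (Fin m → ℝ)) : AddSubgroup (Fin m → ℤ) :=
  AddSubgroup.closure {a | a ∈ M ∧ toReal a ∈ F}

/-- For a facet `F = F_i` this is the monoid
`M_i = {a ∈ gp(M) : a + b ∈ M for some b ∈ M ∩ F_i}`. -/
def facetLoc (M : AddSubmonoid (Fin m → ℤ)) (F : Set (Fin m → ℝ)) : Set (Fin m → ℤ) :=
  {a | a ∈ gp M ∧ ∃ b ∈ M, toReal b ∈ F ∧ a + b ∈ M}

/-- `M'`, the intersection of the `M_i` over the facets of `cn(M)`, taken inside `gp(M)`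
(so that it is `gp(M)` if `cn(M)` is a linear subspace and there are no facets). -/
def prime (M : AddSubmonoid (Fin m → ℤ)) : Set (Fin m → ℤ) :=
  {a | a ∈ gp M ∧ ∀ F, IsFacet (cn M) F → a ∈ facetLoc M F}

/-- `M` is seminormal if `z ∈ gp(M)`, `2z ∈ M`, `3z ∈ M` imply `z ∈ M`. -/
def IsSeminormal (M : AddSubmonoid (Fin m → ℤ)) : Prop :=
  ∀ z ∈ gp M, 2 • z ∈ M → 3 • z ∈ M → z ∈ M

/-- `gp(M) ∩ relint cn(M) ⊆ M`. -/
def ContainsInterior (M : AddSubmonoid (Fin m → ℤ)) : Prop :=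
  ∀ a ∈ gp M, toReal a ∈ relint (cn M) → a ∈ M

/-- For all proper faces `F` of `cn(M)`:
`M ∩ relint F = (⋂_{F ⊆ F_j} gp(M ∩ F_j)) ∩ relint F`, the `F_j` being facets. -/
def InteriorCondition (M : AddSubmonoid (Fin m → ℤ)) : Prop :=
  ∀ F, IsProperFace (cn M) F →
    {a : Fin m → ℤ | a ∈ M ∧ toReal a ∈ relint F} =
      {a | (∀ G, IsFacet (cn M) G → F ⊆ G → a ∈ gpInter M G) ∧ toReal a ∈ relint F}

/-- For all proper faces `F` of `cn(M)`: `gp(M ∩ F) = ⋂_{F ⊆ F_j} gp(M ∩ F_j)`,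
the `F_j` being facets. -/
def GroupCondition (M : AddSubmonoid (Fin m → ℤ)) : Prop :=
  ∀ F, IsProperFace (cn M) F →
    (gpInter M F : Set (Fin m → ℤ)) =
      {a | ∀ G, IsFacet (cn M) G → F ⊆ G → a ∈ gpInter M G}

end AffineMonoid

end

/-! The equivalence of (i) and (ii) holds for every affine monoid. In a Noetherian domain, `(S₂)`
says that every prime of the form `Q = (b : c)` with `b ≠ 0` has height at most one
(`satisfiesS_two_iff`). The monomials outside a facet `G` span a prime `P_G` of height one.

Suppose `(S₂)` holds and `x = p - q` lies in `M'` but not in `M`. Then `X^q` does not divide `X^p`,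
so some prime `Q = (X^q : c)` contains `(X^q : X^p)`. The monomials outside `Q` have exponents in
one facet `G`, so `P_G ⊆ Q`. Since `x ∈ M_G`, `Q` also contains a monomial with exponent in `G`;
hence `0 ⊂ P_G ⊂ Q` is strict and `Q` has height at least two.

Conversely, suppose `M = M'` and `Q = (b : c)` has height at least two. Multiplication by `c/b` maps
`Q` into itself, so `c/b` is integral over the Laurent polynomial ring and hence lies in it. No
`P_G` contains `Q`, and an element of `Q` outside `P_G` forces the exponents of `c/b` into `M_G`.
They therefore lie in `M' = M`, so `b` divides `c`, a contradiction.

The other equivalences are convex geometry: `M'` lies in the cone, each point of the cone is in the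
relative interior of a face, and large multiples of an interior lattice point absorb translations
(`exists_forall_nsmul_add_mem`). Seminormality descends from those multiples to the point itself,
for `M` and for each `M ∩ F`. -/

/-! ### Separation for finitely generated cones. -/

section Farkas

open Set

variable {E : Type*} [AddCommGroup E] [Module ℝ E]

/-- Induction on the number of generators. If the form `β` found for the others is negative on `g
0`, project along `g 0` onto its kernel and separate there; the pulled-back form vanishes on `g 0`.
-/
theorem exists_linearMap_neg_of_notMem_hull_range :
    ∀ (n : ℕ) (g : Fin n → E) (a : E), a ∉ PointedCone.hull ℝ (range g) →
      ∃ β : E →ₗ[ℝ] ℝ, (∀ i, 0 ≤ β (g i)) ∧ β a < 0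
  | 0, g, a, ha => by
    have ha0 : a ≠ 0 := by rintro rfl; exact ha (zero_mem _)
    have : ¬ ∀ f : Module.Dual ℝ E, f a = 0 := fun h ↦
      ha0 ((Module.forall_dual_apply_eq_zero_iff ℝ a).1 h)
    push Not at this
    obtain ⟨f, hf⟩ := this
    rcases hf.lt_or_gt with h | h
    · exact ⟨f, fun i ↦ i.elim0, h⟩
    · exact ⟨-f, fun i ↦ i.elim0, by simpa using h⟩
  | n + 1, g, a, ha => by
    have hmem : ∀ i, g i ∈ PointedCone.hull ℝ (range g) := fun i ↦ Submodule.subset_span ⟨i, rfl⟩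
    obtain ⟨β, hβ, hβa⟩ := exists_linearMap_neg_of_notMem_hull_range n (fun i ↦ g i.succ) a
      fun h ↦ ha (Submodule.span_mono (by rintro _ ⟨i, rfl⟩; exact ⟨_, rfl⟩) h)
    by_cases h0 : 0 ≤ β (g 0)
    · exact ⟨β, fun i ↦ i.cases h0 hβ, hβa⟩
    push Not at h0
    let p : E →ₗ[ℝ] E := LinearMap.id - (β.smulRight ((β (g 0))⁻¹ • g 0))
    have hp : ∀ v, p v = v - (β v * (β (g 0))⁻¹) • g 0 := fun v ↦ by simp [p, smul_smul]
    have hp0 : p (g 0) = 0 := by rw [hp, mul_inv_cancel₀ h0.ne]; simp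
    obtain ⟨γ, hγ, hγa⟩ := exists_linearMap_neg_of_notMem_hull_range n
        (fun i ↦ p (g i.succ)) (p a) (by
      intro h
      apply ha
      -- As `β (g 0) < 0 ≤ β (g i.succ)`, projecting a generator only adds a nonnegative multiple of
      -- `g 0`; the same sign count recovers `a` from `p a`.
      have h1 : p a ∈ PointedCone.hull ℝ (range g) := by
        refine Submodule.span_le.2 ?_ h
        rintro _ ⟨i, rfl⟩
        simp only [hp, sub_eq_add_neg, ← neg_smul, SetLike.mem_coe]
        refine add_mem (hmem _) (PointedCone.smul_mem _ ?_ (hmem 0))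
        rw [neg_nonneg]
        exact mul_nonpos_of_nonneg_of_nonpos (hβ i) (inv_nonpos.2 h0.le)
      have h2 : a = p a + (β a * (β (g 0))⁻¹) • g 0 := by rw [hp]; abel
      rw [h2]
      exact add_mem h1 (PointedCone.smul_mem _
        (mul_nonneg_of_nonpos_of_nonpos hβa.le (inv_nonpos.2 h0.le)) (hmem 0)))
    exact ⟨γ ∘ₗ p, fun i ↦ i.cases (by simp [hp0]) hγ, hγa⟩

/-- **Farkas' lemma** for finitely generated cones. -/
theorem Set.Finite.exists_linearMap_neg_of_notMem_hull {S : Set E} (hS : S.Finite) {a : E}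
    (ha : a ∉ PointedCone.hull ℝ S) :
    ∃ β : E →ₗ[ℝ] ℝ, (∀ x ∈ PointedCone.hull ℝ S, 0 ≤ β x) ∧ β a < 0 := by
  obtain ⟨n, g, rfl⟩ := hS.fin_embedding
  obtain ⟨β, hβ, hβa⟩ := exists_linearMap_neg_of_notMem_hull_range n g a ha
  refine ⟨β, fun x hx ↦ ?_, hβa⟩
  induction hx using Submodule.span_induction with
  | mem x h => obtain ⟨i, rfl⟩ := h; exact hβ i
  | zero => simp
  | add x y _ _ hx hy => rw [map_add]; exact add_nonneg hx hy
  | smul r x _ hx =>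
    change 0 ≤ β ((r : ℝ) • x)
    rw [map_smul]
    exact mul_nonneg r.2 hx

end Farkas

/-! ### Relative interior of a convex cone. -/

section Interior

open Set

variable {E : Type*} [NormedAddCommGroup E] [NormedSpace ℝ E]

theorem PointedCone.mem_affineSpan_of_smul_sub {C : PointedCone ℝ E} {y w : E} (r : ℝ)
    (hy : y ∈ affineSpan ℝ (C : Set E)) (hw : w ∈ affineSpan ℝ (C : Set E)) :
    r • (y - w) ∈ affineSpan ℝ (C : Set E) := by
  have h0 : (0 : E) ∈ affineSpan ℝ (C : Set E) := subset_affineSpan _ _ (zero_mem C)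
  simpa using AffineSubspace.smul_vsub_vadd_mem _ r hy hw h0

/-- A point of a cone `C` is in the relative interior iff it stays in `C` when moved a little in the
direction opposite to any point of `C`. -/
theorem PointedCone.mem_intrinsicInterior_iff [FiniteDimensional ℝ E]
    {C : PointedCone ℝ E} {x : E} :
    x ∈ intrinsicInterior ℝ (C : Set E) ↔
      x ∈ C ∧ ∀ y ∈ C, ∃ ε > (0 : ℝ), x - ε • y ∈ C := by
  constructor
  · intro hx
    refine ⟨intrinsicInterior_subset hx, fun y hy ↦ ?_⟩
    obtain ⟨x, hxi, rfl⟩ := mem_intrinsicInterior.1 hx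
    have hya : y ∈ affineSpan ℝ (C : Set E) := subset_affineSpan _ _ hy
    let φ : ℝ → affineSpan ℝ (C : Set E) := fun t ↦
      ⟨(1 : ℝ) • (x - t • y), PointedCone.mem_affineSpan_of_smul_sub _ x.2 (by
        simpa using PointedCone.mem_affineSpan_of_smul_sub t hya
          (subset_affineSpan _ _ (zero_mem C)))⟩
    have hφ : Continuous φ := by
      refine Continuous.subtype_mk ?_ _
      fun_prop
    have hφ0 : φ 0 = x := by ext; simp [φ]
    have hev : ∀ᶠ t in nhds (0 : ℝ), φ t ∈ ((↑) ⁻¹' (C : Set E) : Set (affineSpan ℝ (C : Set E))) :=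
      hφ.continuousAt.eventually_mem (by rw [hφ0]; exact mem_interior_iff_mem_nhds.1 hxi)
    obtain ⟨ε, hε, h⟩ := Metric.eventually_nhds_iff.1 hev
    refine ⟨ε / 2, by positivity, ?_⟩
    have := h (y := ε / 2) (by rw [Real.dist_eq, sub_zero, abs_of_pos (by positivity)]; linarith)
    simpa [φ] using this
  · rintro ⟨hxC, hx⟩
    obtain ⟨z, hz⟩ := Set.Nonempty.intrinsicInterior (s := (C : Set E)) C.convex ⟨0, zero_mem C⟩
    obtain ⟨z, hzi, rfl⟩ := mem_intrinsicInterior.1 hz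
    have hzC : (z : E) ∈ C := intrinsicInterior_subset hz
    obtain ⟨ε, hε, hw⟩ := hx z hzC
    have hxa : x ∈ affineSpan ℝ (C : Set E) := subset_affineSpan _ _ hxC
    have hwa : x - ε • (z : E) ∈ affineSpan ℝ (C : Set E) := subset_affineSpan _ _ hw
    -- With `w = x - ε • z ∈ C`, this map inverts `y ↦ ε • y + w` and sends `x` to the interior
    -- point `z`. Points near `x` thus go into `C`, and mapping back keeps them in `C`.
    let ψ : affineSpan ℝ (C : Set E) → affineSpan ℝ (C : Set E) := fun y ↦
      ⟨ε⁻¹ • (y - (x - ε • (z : E))), PointedCone.mem_affineSpan_of_smul_sub _ y.2 hwa⟩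
    have hψ : Continuous ψ := by
      refine Continuous.subtype_mk ?_ _
      fun_prop
    have hψx : ψ ⟨x, hxa⟩ = z := by ext; simp [ψ, hε.ne']
    refine mem_intrinsicInterior.2 ⟨⟨x, hxa⟩, mem_interior_iff_mem_nhds.2 ?_, rfl⟩
    have hev : ∀ᶠ y in nhds (⟨x, hxa⟩ : affineSpan ℝ (C : Set E)),
        ψ y ∈ ((↑) ⁻¹' (C : Set E) : Set (affineSpan ℝ (C : Set E))) :=
      hψ.continuousAt.eventually_mem (by rw [hψx]; exact mem_interior_iff_mem_nhds.1 hzi)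
    filter_upwards [hev] with y hy
    have h1 := add_mem (PointedCone.smul_mem C hε.le hy) hw
    simpa [ψ, hε.ne'] using h1

end Interior

/-! ### The cone of an affine monoid. -/

namespace AffineMonoid

open Set

variable {m : ℕ}

theorem toReal_zero : toReal (0 : Fin m → ℤ) = 0 := by ext; simp [toReal]

theorem toReal_add (a b : Fin m → ℤ) : toReal (a + b) = toReal a + toReal b := by
  ext; simp [toReal]

theorem toReal_sub (a b : Fin m → ℤ) : toReal (a - b) = toReal a - toReal b := by
  ext; simp [toReal]

theorem toReal_nsmul (k : ℕ) (a : Fin m → ℤ) : toReal (k • a) = (k : ℝ) • toReal a := by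
  ext; simp [toReal]

theorem toReal_sum {ι : Type*} (s : Finset ι) (f : ι → Fin m → ℤ) :
    toReal (∑ i ∈ s, f i) = ∑ i ∈ s, toReal (f i) := by
  ext; simp [toReal]

variable {M : AddSubmonoid (Fin m → ℤ)} {F G : Set (Fin m → ℝ)}

section Basic

theorem zero_mem_cn (M : AddSubmonoid (Fin m → ℤ)) : (0 : Fin m → ℝ) ∈ cn M :=
  zero_mem (PointedCone.hull ℝ _)

theorem add_mem_cn {x y : Fin m → ℝ} (hx : x ∈ cn M) (hy : y ∈ cn M) : x + y ∈ cn M :=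
  add_mem (S := PointedCone ℝ (Fin m → ℝ)) hx hy

theorem smul_mem_cn {x : Fin m → ℝ} {r : ℝ} (hr : 0 ≤ r) (hx : x ∈ cn M) : r • x ∈ cn M :=
  PointedCone.smul_mem _ hr hx

theorem toReal_mem_cn {a : Fin m → ℤ} (ha : a ∈ M) : toReal a ∈ cn M :=
  Submodule.subset_span ⟨a, ha, rfl⟩

theorem sum_mem_cn {ι : Type*} {s : Finset ι} {f : ι → Fin m → ℝ} (h : ∀ i ∈ s, f i ∈ cn M) :
    ∑ i ∈ s, f i ∈ cn M :=
  Submodule.sum_mem (PointedCone.hull ℝ (toReal '' (M : Set (Fin m → ℤ)))) h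

theorem cn_mono {N : AddSubmonoid (Fin m → ℤ)} (h : N ≤ M) : cn N ⊆ cn M :=
  Submodule.span_mono (image_mono h)

theorem mem_gp_iff {a : Fin m → ℤ} : a ∈ gp M ↔ ∃ p ∈ M, ∃ q ∈ M, a = p - q := by
  constructor
  · intro h
    induction h using AddSubgroup.closure_induction with
    | mem x hx => exact ⟨x, hx, 0, zero_mem _, by simp⟩
    | zero => exact ⟨0, zero_mem _, 0, zero_mem _, by simp⟩
    | add x y _ _ hx hy =>
      obtain ⟨p, hp, q, hq, rfl⟩ := hx
      obtain ⟨p', hp', q', hq', rfl⟩ := hy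
      exact ⟨p + p', add_mem hp hp', q + q', add_mem hq hq', by abel⟩
    | neg x _ hx =>
      obtain ⟨p, hp, q, hq, rfl⟩ := hx
      exact ⟨q, hq, p, hp, by abel⟩
  · rintro ⟨p, hp, q, hq, rfl⟩
    exact sub_mem (AddSubgroup.subset_closure hp) (AddSubgroup.subset_closure hq)

theorem mem_gp_of_mem {a : Fin m → ℤ} (ha : a ∈ M) : a ∈ gp M := AddSubgroup.subset_closure ha

theorem cn_nonneg_of_nonneg {β : (Fin m → ℝ) →ₗ[ℝ] ℝ} (h : ∀ a ∈ M, 0 ≤ β (toReal a))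
    {x : Fin m → ℝ} (hx : x ∈ cn M) : 0 ≤ β x := by
  obtain ⟨c, hc, hc0, rfl⟩ := PointedCone.mem_hull_set.1 hx
  rw [Finsupp.sum, map_sum]
  refine Finset.sum_nonneg fun y hy ↦ ?_
  obtain ⟨a, ha, rfl⟩ := hc hy
  rw [map_smul]
  exact mul_nonneg (hc0 _) (h a ha)

theorem cn_closure (S : Set (Fin m → ℤ)) :
    cn (AddSubmonoid.closure S) = (PointedCone.hull ℝ (toReal '' S) : Set (Fin m → ℝ)) := by
  refine subset_antisymm ?_ (Submodule.span_mono (image_mono AddSubmonoid.subset_closure))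
  refine SetLike.coe_subset_coe.2 (Submodule.span_le.2 ?_)
  rintro _ ⟨a, ha, rfl⟩
  simp only [SetLike.mem_coe] at ha ⊢
  induction ha using AddSubmonoid.closure_induction with
  | mem x hx => exact Submodule.subset_span ⟨x, hx, rfl⟩
  | zero => rw [toReal_zero]; exact zero_mem _
  | add x y _ _ hx hy => rw [toReal_add]; exact add_mem hx hy

theorem mem_cn_closure_iff {T : Finset (Fin m → ℤ)} {x : Fin m → ℝ} :
    x ∈ cn (AddSubmonoid.closure (T : Set (Fin m → ℤ))) ↔
      ∃ c : (Fin m → ℤ) → ℝ, (∀ a, 0 ≤ c a) ∧ ∑ a ∈ T, c a • toReal a = x := by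
  rw [cn_closure, SetLike.mem_coe, Submodule.mem_span_image_finset_iff_exists_fun']
  constructor
  · rintro ⟨c, rfl⟩
    exact ⟨fun a ↦ c a, fun a ↦ (c a).2, rfl⟩
  · rintro ⟨c, hc, rfl⟩
    exact ⟨fun a ↦ ⟨c a, hc a⟩, rfl⟩

theorem exists_linearMap_neg_of_notMem_cn (hM : M.FG) {x : Fin m → ℝ} (hx : x ∉ cn M) :
    ∃ β : (Fin m → ℝ) →ₗ[ℝ] ℝ, (∀ y ∈ cn M, 0 ≤ β y) ∧ β x < 0 := by
  obtain ⟨T, rfl⟩ := hM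
  rw [cn_closure] at hx ⊢
  exact (T.finite_toSet.image _).exists_linearMap_neg_of_notMem_hull hx

/-- By Farkas' lemma the cone is an intersection of closed half-spaces. -/
theorem isClosed_cn (hM : M.FG) : IsClosed (cn M) := by
  have : cn M = ⋂ β ∈ {β : (Fin m → ℝ) →ₗ[ℝ] ℝ | ∀ y ∈ cn M, 0 ≤ β y}, {x | 0 ≤ β x} := by
    ext x
    simp only [mem_iInter, mem_ofPred_eq]
    refine ⟨fun hx β hβ ↦ hβ x hx, fun h ↦ by_contra fun hx ↦ ?_⟩
    obtain ⟨β, hβ, hβx⟩ := exists_linearMap_neg_of_notMem_cn hM hx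
    exact hβx.not_ge (h β hβ)
  rw [this]
  exact isClosed_biInter fun β _ ↦
    isClosed_le continuous_const β.continuous_of_finiteDimensional

/-- The sum of the generators dominates every element of the cone. -/
theorem exists_order_unit (hM : M.FG) :
    ∃ s ∈ M, ∀ y ∈ cn M, ∃ k : ℝ, 0 < k ∧ k • toReal s - y ∈ cn M := by
  obtain ⟨T, rfl⟩ := hM
  have hT : ∀ a ∈ T, a ∈ AddSubmonoid.closure (T : Set (Fin m → ℤ)) := fun a ha ↦
    AddSubmonoid.subset_closure ha
  refine ⟨∑ a ∈ T, a, sum_mem hT, fun y hy ↦ ?_⟩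
  obtain ⟨c, hc, rfl⟩ := mem_cn_closure_iff.1 hy
  -- The summand `1` keeps the factor positive when all coefficients vanish.
  refine ⟨∑ a ∈ T, c a + 1, add_pos_of_nonneg_of_pos (Finset.sum_nonneg fun a _ ↦ hc a) one_pos, ?_⟩
  rw [toReal_sum, Finset.smul_sum, ← Finset.sum_sub_distrib]
  refine sum_mem_cn fun a ha ↦ ?_
  rw [← sub_smul]
  refine smul_mem_cn ?_ (toReal_mem_cn (hT a ha))
  have := Finset.single_le_sum (fun a _ ↦ hc a) ha
  linarith

end Basic

/-! ### Faces and facets. -/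

section Face

/-- The submonoid generated by the elements of `M` in `F`. -/
def interMonoid (M : AddSubmonoid (Fin m → ℤ)) (F : Set (Fin m → ℝ)) :
    AddSubmonoid (Fin m → ℤ) :=
  AddSubmonoid.closure {a | a ∈ M ∧ toReal a ∈ F}

theorem IsFace.subset (hF : IsFace (cn M) F) : F ⊆ cn M := by
  obtain ⟨β, -, rfl⟩ := hF
  exact sep_subset _ _

theorem isFace_self (M : AddSubmonoid (Fin m → ℤ)) : IsFace (cn M) (cn M) :=
  ⟨0, by simp, by simp⟩

theorem IsFace.add_mem_iff (hF : IsFace (cn M) F) {x y : Fin m → ℝ} (hx : x ∈ cn M)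
    (hy : y ∈ cn M) : x + y ∈ F ↔ x ∈ F ∧ y ∈ F := by
  obtain ⟨β, hβ, rfl⟩ := hF
  have h1 := hβ x hx
  have h2 := hβ y hy
  simp only [mem_ofPred_eq, hx, hy, add_mem_cn hx hy, map_add, true_and]
  constructor
  · intro h; constructor <;> linarith
  · rintro ⟨h, h'⟩; linarith

theorem IsFace.zero_mem (hF : IsFace (cn M) F) : (0 : Fin m → ℝ) ∈ F := by
  obtain ⟨β, hβ, rfl⟩ := hF
  exact ⟨zero_mem_cn M, by simp⟩

theorem IsFace.smul_mem (hF : IsFace (cn M) F) {x : Fin m → ℝ} {r : ℝ} (hr : 0 ≤ r)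
    (hx : x ∈ F) : r • x ∈ F := by
  obtain ⟨β, hβ, rfl⟩ := hF
  exact ⟨smul_mem_cn hr hx.1, by simp [hx.2]⟩

theorem IsFace.mem_interMonoid (hF : IsFace (cn M) F) {a : Fin m → ℤ} :
    a ∈ interMonoid M F ↔ a ∈ M ∧ toReal a ∈ F := by
  refine ⟨fun h ↦ ?_, fun h ↦ AddSubmonoid.subset_closure h⟩
  induction h using AddSubmonoid.closure_induction with
  | mem x hx => exact hx
  | zero => exact ⟨M.zero_mem, by rw [toReal_zero]; exact hF.zero_mem⟩
  | add x y _ _ hx hy =>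
    refine ⟨add_mem hx.1 hy.1, ?_⟩
    rw [toReal_add]
    exact (hF.add_mem_iff (hF.subset hx.2) (hF.subset hy.2)).2 ⟨hx.2, hy.2⟩

/-- A nonnegative combination killed by `β` involves only elements killed by `β`. This lets results
about `cn M` be applied to its faces. -/
theorem IsFace.cn_interMonoid (hF : IsFace (cn M) F) : cn (interMonoid M F) = F := by
  obtain ⟨β, hβ, rfl⟩ := id hF
  apply subset_antisymm
  · intro x hx
    refine ⟨cn_mono (fun a ha ↦ (hF.mem_interMonoid.1 ha).1) hx, ?_⟩
    refine le_antisymm ?_ (hβ x (cn_mono (fun a ha ↦ (hF.mem_interMonoid.1 ha).1) hx))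
    have := cn_nonneg_of_nonneg (β := -β) (fun a ha ↦ by
      simp [(hF.mem_interMonoid.1 ha).2.2]) hx
    simpa using this
  · rintro x ⟨hx, hβx⟩
    obtain ⟨c, hc, hc0, rfl⟩ := PointedCone.mem_hull_set.1 hx
    rw [Finsupp.sum, map_sum, Finset.sum_eq_zero_iff_of_nonneg] at hβx
    · refine sum_mem_cn fun y hy ↦ ?_
      obtain ⟨a, ha, rfl⟩ := hc hy
      have h := hβx _ hy
      rw [map_smul, smul_eq_mul, mul_eq_zero] at h
      exact smul_mem_cn (hc0 _) (toReal_mem_cn (hF.mem_interMonoid.2 ⟨ha, toReal_mem_cn ha,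
        h.resolve_left (Finsupp.mem_support_iff.1 hy)⟩))
    · intro y hy
      obtain ⟨a, ha, rfl⟩ := hc hy
      rw [map_smul]
      exact mul_nonneg (hc0 _) (hβ _ (toReal_mem_cn ha))

theorem IsFace.interMonoid_closure {T : Finset (Fin m → ℤ)}
    (hF : IsFace (cn (AddSubmonoid.closure (T : Set (Fin m → ℤ)))) F) :
    interMonoid (AddSubmonoid.closure (T : Set (Fin m → ℤ))) F =
      AddSubmonoid.closure {a | a ∈ T ∧ toReal a ∈ F} := by
  refine le_antisymm (fun a ha ↦ ?_) (AddSubmonoid.closure_mono fun a ha ↦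
    ⟨AddSubmonoid.subset_closure ha.1, ha.2⟩)
  obtain ⟨haM, haF⟩ := hF.mem_interMonoid.1 ha
  clear ha
  induction haM using AddSubmonoid.closure_induction with
  | mem x hx => exact AddSubmonoid.subset_closure ⟨hx, haF⟩
  | zero => exact AddSubmonoid.zero_mem _
  | add x y hx' hy' hx hy =>
    rw [toReal_add, hF.add_mem_iff (toReal_mem_cn hx') (toReal_mem_cn hy')] at haF
    exact add_mem (hx haF.1) (hy haF.2)

theorem IsFace.interMonoid_fg (hM : M.FG) (hF : IsFace (cn M) F) : (interMonoid M F).FG := by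
  classical
  obtain ⟨T, rfl⟩ := hM
  rw [hF.interMonoid_closure]
  exact ⟨T.filter (fun a ↦ toReal a ∈ F), by simp⟩

theorem gp_interMonoid (M : AddSubmonoid (Fin m → ℤ)) (F : Set (Fin m → ℝ)) :
    gp (interMonoid M F) = gpInter M F := by
  refine le_antisymm ?_ (AddSubgroup.closure_mono AddSubmonoid.subset_closure)
  refine (AddSubgroup.closure_le _).2 ?_
  exact SetLike.coe_subset_coe.2 (show _ ≤ (gpInter M F).toAddSubmonoid from
    AddSubmonoid.closure_le.2 AddSubgroup.subset_closure)

theorem gpInter_le_gp (M : AddSubmonoid (Fin m → ℤ)) (F : Set (Fin m → ℝ)) :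
    gpInter M F ≤ gp M := AddSubgroup.closure_mono fun _ h ↦ h.1

theorem gpInter_mono (M : AddSubmonoid (Fin m → ℤ)) (h : F ⊆ G) : gpInter M F ≤ gpInter M G :=
  AddSubgroup.closure_mono fun _ ha ↦ ⟨ha.1, h ha.2⟩

theorem mem_gpInter_of_mem {a : Fin m → ℤ} (ha : a ∈ M) (haF : toReal a ∈ F) :
    a ∈ gpInter M F := AddSubgroup.subset_closure ⟨ha, haF⟩

theorem IsFace.mem_gpInter_iff (hF : IsFace (cn M) F) {a : Fin m → ℤ} :
    a ∈ gpInter M F ↔ ∃ p ∈ M, toReal p ∈ F ∧ ∃ q ∈ M, toReal q ∈ F ∧ a = p - q := by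
  simp [← gp_interMonoid, mem_gp_iff, hF.mem_interMonoid, and_assoc]

/-- A face is determined by the generators it contains. -/
theorem finite_setOf_isFace (hM : M.FG) : {F | IsFace (cn M) F}.Finite := by
  obtain ⟨T, rfl⟩ := hM
  refine (T.finite_toSet.powerset.image
    fun U ↦ (PointedCone.hull ℝ (toReal '' U) : Set (Fin m → ℝ))).subset fun F hF ↦ ?_
  refine ⟨{a | a ∈ T ∧ toReal a ∈ F}, fun a ha ↦ ha.1, ?_⟩
  simp only
  rw [← cn_closure, ← hF.interMonoid_closure, hF.cn_interMonoid]

theorem IsFacet.isFace (hG : IsFacet (cn M) G) : IsFace (cn M) G := hG.prop.1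

theorem IsProperFace.exists_isFacet (hM : M.FG) (hF : IsProperFace (cn M) F) :
    ∃ G, IsFacet (cn M) G ∧ F ⊆ G := by
  obtain ⟨G, hFG, hG⟩ := ((finite_setOf_isFace hM).subset
    (t := {F | IsProperFace (cn M) F}) fun F hF ↦ hF.1).exists_le_maximal hF
  exact ⟨G, hG, hFG⟩

/-- If `β` cuts out `F` and `γ` cuts out `G` in `F`, then `γ + t • β` cuts out `G` for large `t`. -/
theorem IsFace.trans (hM : M.FG) (hF : IsFace (cn M) F) (hG : IsFace F G) : IsFace (cn M) G := by
  obtain ⟨T, rfl⟩ := hM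
  obtain ⟨β, hβ, rfl⟩ := id hF
  obtain ⟨γ, hγ, rfl⟩ := hG
  have hT : ∀ a ∈ T, toReal a ∈ cn (AddSubmonoid.closure (T : Set (Fin m → ℤ))) := fun a ha ↦
    toReal_mem_cn (AddSubmonoid.subset_closure ha)
  -- Generators in `F` contribute `0` by division by zero; the `1` makes the new form strictly
  -- positive on the generators outside `F`.
  let t : ℝ := ∑ a ∈ T, |γ (toReal a)| / β (toReal a) + 1
  have hterm : ∀ a ∈ T, 0 ≤ |γ (toReal a)| / β (toReal a) := fun a ha ↦
    div_nonneg (abs_nonneg _) (hβ _ (hT a ha))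
  have key : ∀ a ∈ T, 0 ≤ (γ + t • β) (toReal a) ∧
      ((γ + t • β) (toReal a) = 0 → β (toReal a) = 0) := by
    intro a ha
    simp only [LinearMap.add_apply, LinearMap.smul_apply, smul_eq_mul]
    rcases (hβ _ (hT a ha)).eq_or_lt with h | h
    · rw [← h]
      exact ⟨by simpa using hγ _ ⟨hT a ha, h.symm⟩, fun _ ↦ rfl⟩
    · have h1 : |γ (toReal a)| / β (toReal a) + 1 ≤ t := by
        have := Finset.single_le_sum hterm ha
        simp only [t]; linarith
      have h2 : |γ (toReal a)| + β (toReal a) ≤ t * β (toReal a) := by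
        have := mul_le_mul_of_nonneg_right h1 h.le
        rwa [add_mul, div_mul_cancel₀ _ h.ne', one_mul] at this
      have h3 := neg_abs_le (γ (toReal a))
      exact ⟨by linarith, fun h4 ↦ by linarith⟩
  refine ⟨γ + t • β, fun x hx ↦ ?_, ?_⟩
  · obtain ⟨c, hc, rfl⟩ := mem_cn_closure_iff.1 hx
    rw [map_sum]
    exact Finset.sum_nonneg fun a ha ↦ by
      rw [map_smul]; exact mul_nonneg (hc a) (key a ha).1
  · ext x
    constructor
    · rintro ⟨⟨hx, hβx⟩, hγx⟩
      exact ⟨hx, by simp [hβx, hγx]⟩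
    · rintro ⟨hx, h0⟩
      have hβx : β x = 0 := by
        obtain ⟨c, hc, rfl⟩ := mem_cn_closure_iff.1 hx
        rw [map_sum, Finset.sum_eq_zero_iff_of_nonneg fun a ha ↦ by
          rw [map_smul]; exact mul_nonneg (hc a) (key a ha).1] at h0
        rw [map_sum]
        refine Finset.sum_eq_zero fun a ha ↦ ?_
        have := h0 a ha
        rw [map_smul, smul_eq_mul, mul_eq_zero] at this
        rw [map_smul, smul_eq_mul, mul_eq_zero]
        exact this.imp_right (key a ha).2
      exact ⟨⟨hx, hβx⟩, by simpa [hβx] using h0⟩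

end Face

end AffineMonoid

namespace AffineMonoid

open Set

variable {m : ℕ}

variable {M : AddSubmonoid (Fin m → ℤ)} {F G : Set (Fin m → ℝ)}

/-! ### Relative interiors of faces and supporting hyperplanes. -/

section Relint

theorem mem_relint_cn_iff {x : Fin m → ℝ} :
    x ∈ relint (cn M) ↔ x ∈ cn M ∧ ∀ y ∈ cn M, ∃ ε > (0 : ℝ), x - ε • y ∈ cn M :=
  PointedCone.mem_intrinsicInterior_iff

theorem mem_relint_cn_of_order_unit {s x : Fin m → ℝ}
    (hs : ∀ y ∈ cn M, ∃ k : ℝ, 0 < k ∧ k • s - y ∈ cn M) (hx : x ∈ cn M) {ε : ℝ} (hε : 0 < ε)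
    (h : x - ε • s ∈ cn M) : x ∈ relint (cn M) := by
  refine mem_relint_cn_iff.2 ⟨hx, fun y hy ↦ ?_⟩
  obtain ⟨k, hk, hky⟩ := hs y hy
  refine ⟨ε / k, by positivity, ?_⟩
  have : x - (ε / k) • y = (x - ε • s) + (ε / k) • (k • s - y) := by
    rw [smul_sub, smul_smul, div_mul_cancel₀ _ hk.ne']; abel
  rw [this]
  exact add_mem_cn h (smul_mem_cn (by positivity) hky)

theorem exists_mem_relint_cn (hM : M.FG) : ∃ s ∈ M, toReal s ∈ relint (cn M) := by
  obtain ⟨s, hsM, hs⟩ := exists_order_unit hM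
  refine ⟨s, hsM, mem_relint_cn_of_order_unit hs (toReal_mem_cn hsM) one_half_pos ?_⟩
  have : toReal s - (1 / 2 : ℝ) • toReal s = (1 / 2 : ℝ) • toReal s := by
    rw [sub_eq_iff_eq_add, ← add_smul]; norm_num
  rw [this]
  exact smul_mem_cn (by norm_num) (toReal_mem_cn hsM)

theorem IsFace.exists_mem_relint (hM : M.FG) (hF : IsFace (cn M) F) :
    ∃ s ∈ M, toReal s ∈ F ∧ toReal s ∈ relint F := by
  obtain ⟨s, hs, h⟩ := exists_mem_relint_cn (hF.interMonoid_fg hM)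
  rw [hF.cn_interMonoid] at h
  exact ⟨s, (hF.mem_interMonoid.1 hs).1, (hF.mem_interMonoid.1 hs).2, h⟩

theorem relint_subset (F : Set (Fin m → ℝ)) : relint F ⊆ F := intrinsicInterior_subset

/-- For `y ∈ F` the point `x` is the sum of `x - ε • y` and `ε • y`, and a face containing a sum
contains its summands. -/
theorem IsFace.subset_of_mem_relint (hF : IsFace (cn M) F) (hG : IsFace (cn M) G)
    {x : Fin m → ℝ} (hxF : x ∈ relint F) (hxG : x ∈ G) : F ⊆ G := by
  intro y hy
  rw [← hF.cn_interMonoid] at hxF hy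
  obtain ⟨ε, hε, h⟩ := (mem_relint_cn_iff.1 hxF).2 y hy
  rw [hF.cn_interMonoid] at h hy
  have h1 := ((hG.add_mem_iff (hF.subset h) (smul_mem_cn hε.le (hF.subset hy))).1
    (by simpa using hxG)).2
  simpa [hε.ne'] using hG.smul_mem (inv_nonneg.2 hε.le) h1

/-- For an order unit `s`, separate `-s` from the cone generated by `cn M` and `-x`. The resulting
form vanishes at `x` and is positive at `s`, so its face is proper. -/
theorem exists_isProperFace_of_notMem_relint (hM : M.FG) {x : Fin m → ℝ} (hx : x ∈ cn M)
    (hxr : x ∉ relint (cn M)) : ∃ F, IsProperFace (cn M) F ∧ x ∈ F := by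
  obtain ⟨s, hsM, hs⟩ := exists_order_unit hM
  have hscn := toReal_mem_cn hsM
  obtain ⟨T, hT⟩ := id hM
  have hcn : cn M = (PointedCone.hull ℝ (toReal '' (T : Set (Fin m → ℤ))) : Set _) := by
    rw [← cn_closure, hT]
  have hnot : - toReal s ∉ PointedCone.hull ℝ (insert (-x) (toReal '' (T : Set (Fin m → ℤ)))) := by
    intro h
    obtain ⟨⟨r, hr⟩, z, hz, h⟩ := Submodule.mem_span_insert.1 h
    replace hz : z ∈ cn M := by rw [hcn]; exact hz
    change - toReal s = r • (-x) + z at h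
    have hz' : z = r • x - toReal s := by rw [smul_neg] at h; rw [sub_eq_add_neg, h]; abel
    rcases hr.eq_or_lt with rfl | hr
    · refine hxr (mem_relint_cn_of_order_unit hs hx one_pos ?_)
      have : x - (1 : ℝ) • toReal s = x + z := by rw [hz']; simp [sub_eq_add_neg]
      rw [this]
      exact add_mem_cn hx hz
    · refine hxr (mem_relint_cn_of_order_unit hs hx (inv_pos.2 hr) ?_)
      have : x - r⁻¹ • toReal s = r⁻¹ • z := by rw [hz', smul_sub, inv_smul_smul₀ hr.ne']
      rw [this]
      exact smul_mem_cn (inv_nonneg.2 hr.le) hz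
  obtain ⟨β, hβ, hβs⟩ := ((T.finite_toSet.image toReal).insert
    (-x)).exists_linearMap_neg_of_notMem_hull hnot
  have hβ' : ∀ y ∈ cn M, 0 ≤ β y := fun y hy ↦ by
    rw [hcn] at hy
    exact hβ y (Submodule.span_mono (subset_insert _ _) hy)
  have h1 := hβ (-x) (Submodule.subset_span (mem_insert _ _))
  have h2 := hβ' x hx
  rw [map_neg] at h1 hβs
  refine ⟨{y ∈ cn M | β y = 0}, ⟨⟨β, hβ', rfl⟩, fun h ↦ ?_⟩, hx, by linarith⟩
  have := (h.symm ▸ hscn : toReal s ∈ {y ∈ cn M | β y = 0}).2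
  linarith

/-- Take a minimal face containing `x`. -/
theorem exists_isFace_mem_relint (hM : M.FG) {x : Fin m → ℝ} (hx : x ∈ cn M) :
    ∃ F, IsFace (cn M) F ∧ x ∈ relint F := by
  obtain ⟨F, -, hF⟩ := ((finite_setOf_isFace hM).subset
    (t := {F | IsFace (cn M) F ∧ x ∈ F}) fun F hF ↦ hF.1).exists_le_minimal ⟨isFace_self M, hx⟩
  refine ⟨F, hF.prop.1, by_contra fun h ↦ ?_⟩
  have hFcn := hF.prop.1.cn_interMonoid
  obtain ⟨G, ⟨hG, hne⟩, hxG⟩ := exists_isProperFace_of_notMem_relint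
    (hF.prop.1.interMonoid_fg hM) (x := x) (by rw [hFcn]; exact hF.prop.2) (by rwa [hFcn])
  have hGF := hG.subset
  rw [hFcn] at hG hne hGF
  exact hne (subset_antisymm hGF (hF.le_of_le ⟨hF.prop.1.trans hM hG, hxG⟩ hGF))

theorem mem_relint_cn_of_notMem_facets (hM : M.FG) {x : Fin m → ℝ} (hx : x ∈ cn M)
    (h : ∀ G, IsFacet (cn M) G → x ∉ G) : x ∈ relint (cn M) := by
  by_contra hxr
  obtain ⟨F, hF, hxF⟩ := exists_isProperFace_of_notMem_relint hM hx hxr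
  obtain ⟨G, hG, hFG⟩ := hF.exists_isFacet hM
  exact h G hG (hFG hxF)

/-- Distinct facets: a point in the relative interior of a facet lies on no other facet. -/
theorem IsFacet.eq_of_mem_relint (hF : IsFacet (cn M) F) (hG : IsFacet (cn M) G)
    {x : Fin m → ℝ} (hxF : x ∈ relint F) (hxG : x ∈ G) : F = G :=
  hF.eq_of_subset hG.prop (hF.isFace.subset_of_mem_relint hG.isFace hxF hxG)

/-- The cone is cut out of its linear span by the facets. -/
theorem mem_cn_of_facets_nonneg (hM : M.FG) {x y : Fin m → ℝ} (hy : y ∈ cn M)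
    (hxy : x + y ∈ cn M)
    (h : ∀ G, IsFacet (cn M) G → ∃ β : (Fin m → ℝ) →ₗ[ℝ] ℝ,
      (∀ z ∈ cn M, 0 ≤ β z) ∧ G = {z ∈ cn M | β z = 0} ∧ 0 ≤ β x) : x ∈ cn M := by
  obtain ⟨s, hsM, hs⟩ := exists_order_unit hM
  have hscn := toReal_mem_cn hsM
  obtain ⟨k, hk, hks⟩ := hs y hy
  -- If the least `t` in `S` is positive, `x + t • s` lies on a facet. Its form is nonnegative at
  -- both `x` and `s`, so it vanishes at `s` and hence on the whole cone, contradicting properness.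
  let S : Set ℝ := {t | 0 ≤ t ∧ x + t • toReal s ∈ cn M}
  have hS : IsClosed S := by
    refine isClosed_Ici.inter ((isClosed_cn hM).preimage ?_)
    fun_prop
  have hkS : k ∈ S := by
    refine ⟨hk.le, ?_⟩
    have : x + k • toReal s = (x + y) + (k • toReal s - y) := by abel
    rw [this]
    exact add_mem_cn hxy hks
  have hbdd : BddBelow S := ⟨0, fun t ht ↦ ht.1⟩
  obtain ⟨h0, ht⟩ := hS.csInf_mem ⟨k, hkS⟩ hbdd
  set t := sInf S
  rcases h0.eq_or_lt with h0 | h0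
  · simpa [← h0] using ht
  by_cases hr : x + t • toReal s ∈ relint (cn M)
  · obtain ⟨ε, hε, hmem⟩ := (mem_relint_cn_iff.1 hr).2 _ hscn
    have : t - min ε t ∈ S := by
      refine ⟨by simp, ?_⟩
      have : x + (t - min ε t) • toReal s =
          (x + t • toReal s - ε • toReal s) + (ε - min ε t) • toReal s := by
        simp only [sub_smul]; abel
      rw [this]
      exact add_mem_cn hmem (smul_mem_cn (by simp) hscn)
    have h1 := csInf_le hbdd this
    have h2 : 0 < min ε t := lt_min hε h0
    change t ≤ _ at h1
    linarith
  · obtain ⟨F, hF, hxF⟩ := exists_isProperFace_of_notMem_relint hM ht hr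
    obtain ⟨G, hG, hFG⟩ := hF.exists_isFacet hM
    obtain ⟨β, hβ, rfl, h1⟩ := h G hG
    have h2 := (hFG hxF).2
    rw [map_add, map_smul, smul_eq_mul] at h2
    have h3 := mul_nonneg h0.le (hβ _ hscn)
    have h4 : t * β (toReal s) = 0 := by linarith
    have h5 : β (toReal s) = 0 := (mul_eq_zero.1 h4).resolve_left h0.ne'
    refine (hG.prop.2 (subset_antisymm (sep_subset _ _) fun z hz ↦ ⟨hz, ?_⟩)).elim
    obtain ⟨l, hl, hlz⟩ := hs z hz
    have h6 := hβ _ hlz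
    rw [map_sub, map_smul, h5, smul_zero, zero_sub] at h6
    exact le_antisymm (by linarith) (hβ z hz)

end Relint

/-! ### Lattice points in the relative interior. -/

section Lattice

theorem finite_setOf_toReal_mem {S : Set (Fin m → ℝ)} (hS : Bornology.IsBounded S) :
    {a : Fin m → ℤ | toReal a ∈ S}.Finite := by
  obtain ⟨R, hR⟩ := hS.exists_norm_le
  refine (Set.finite_Icc (fun _ ↦ -⌈R⌉ : Fin m → ℤ) (fun _ ↦ ⌈R⌉)).subset fun a ha ↦ ?_
  have h : ∀ i, |(a i : ℝ)| ≤ R := fun i ↦ (norm_le_pi_norm (toReal a) i).trans (hR _ ha)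
  have h' : ∀ i, |a i| ≤ ⌈R⌉ := fun i ↦ by
    have := (h i).trans (Int.le_ceil R)
    exact_mod_cast this
  exact ⟨fun i ↦ (abs_le.1 (h' i)).1, fun i ↦ (abs_le.1 (h' i)).2⟩

theorem exists_nsmul_add_mem {T : Finset (Fin m → ℤ)} {x : Fin m → ℤ}
    (hx : x ∈ gp (AddSubmonoid.closure (T : Set (Fin m → ℤ)))) :
    ∃ N : ℕ, ∀ c : (Fin m → ℤ) → ℕ, (∀ a ∈ T, N ≤ c a) →
      ∑ a ∈ T, c a • a + x ∈ AddSubmonoid.closure (T : Set (Fin m → ℤ)) := by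
  obtain ⟨p, hp, q, hq, rfl⟩ := mem_gp_iff.1 hx
  obtain ⟨l, -, hl⟩ := AddSubmonoid.mem_closure_finset.1 hq
  refine ⟨∑ a ∈ T, l a, fun c hc ↦ ?_⟩
  have : ∑ a ∈ T, c a • a + (p - q) = ∑ a ∈ T, (c a - l a) • a + p := by
    have h : ∑ a ∈ T, (c a - l a) • a + q = ∑ a ∈ T, c a • a := by
      rw [← hl, ← Finset.sum_add_distrib]
      refine Finset.sum_congr rfl fun a ha ↦ ?_
      rw [← add_smul, Nat.sub_add_cancel
        ((Finset.single_le_sum (fun _ _ ↦ Nat.zero_le _) ha).trans (hc a ha))]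
    rw [← h]; abel
  rw [this]
  exact add_mem (sum_mem fun a ha ↦ nsmul_mem (AddSubmonoid.subset_closure ha) _) hp

/-- Large multiples of a lattice point in the relative interior absorb translations. -/
theorem exists_forall_nsmul_add_mem (hM : M.FG) {a x : Fin m → ℤ} (ha : a ∈ gp M)
    (har : toReal a ∈ relint (cn M)) (hx : x ∈ gp M) :
    ∃ k₀ : ℕ, ∀ k ≥ k₀, k • a + x ∈ M := by
  obtain ⟨T, rfl⟩ := hM
  have hT : ∀ t ∈ T, t ∈ AddSubmonoid.closure (T : Set (Fin m → ℤ)) := fun t ht ↦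
    AddSubmonoid.subset_closure ht
  obtain ⟨ε, hε, h⟩ := (mem_relint_cn_iff.1 har).2 _
    (toReal_mem_cn (sum_mem hT : ∑ t ∈ T, t ∈ _))
  obtain ⟨c, hc, hsum⟩ := mem_cn_closure_iff.1 h
  have hac : toReal a = ∑ t ∈ T, (c t + ε) • toReal t := by
    simp only [add_smul, Finset.sum_add_distrib, hsum, ← Finset.smul_sum, toReal_sum]
    abel
  -- The rounding errors are lattice points in a fixed ball, so they take finitely many values,
  -- while the rounded coefficients grow with `k` because each `c t + ε` is at least `ε`.
  let r : ℕ → Fin m → ℤ := fun k ↦ k • a - ∑ t ∈ T, ⌊k * (c t + ε)⌋₊ • t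
  have hrgp : ∀ k, r k ∈ gp (AddSubmonoid.closure (T : Set (Fin m → ℤ))) := fun k ↦
    sub_mem (nsmul_mem ha k) (sum_mem fun t ht ↦ nsmul_mem (mem_gp_of_mem (hT t ht)) _)
  have hrb : ∀ k, toReal (r k) ∈ Metric.closedBall (0 : Fin m → ℝ) (∑ t ∈ T, ‖toReal t‖) := by
    intro k
    have : toReal (r k) = ∑ t ∈ T, (k * (c t + ε) - ⌊k * (c t + ε)⌋₊) • toReal t := by
      simp only [r, toReal_sub, toReal_nsmul, toReal_sum, hac, sub_smul, Finset.sum_sub_distrib,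
        Finset.smul_sum, smul_smul]
    rw [mem_closedBall_zero_iff, this]
    refine (norm_sum_le _ _).trans (Finset.sum_le_sum fun t _ ↦ ?_)
    rw [norm_smul, Real.norm_eq_abs]
    refine mul_le_of_le_one_left (norm_nonneg _) (abs_le.2 ⟨?_, ?_⟩)
    · have := Nat.floor_le (a := k * (c t + ε)) (by have := hc t; positivity)
      linarith
    · have := Nat.lt_floor_add_one (k * (c t + ε))
      linarith
  choose! N hN using fun y (hy : y ∈ gp (AddSubmonoid.closure (T : Set (Fin m → ℤ)))) ↦
    exists_nsmul_add_mem hy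
  have hfin := finite_setOf_toReal_mem
    (Metric.isBounded_closedBall (x := (0 : Fin m → ℝ)) (r := ∑ t ∈ T, ‖toReal t‖))
  -- A single bound serving all possible remainders.
  let B := ∑ y ∈ hfin.toFinset, N (y + x)
  obtain ⟨k₀, hk₀⟩ := exists_nat_ge ((B : ℝ) / ε)
  refine ⟨k₀, fun k hk ↦ ?_⟩
  have heq : k • a + x = ∑ t ∈ T, ⌊k * (c t + ε)⌋₊ • t + (r k + x) := by
    simp only [r]; abel
  rw [heq]
  refine hN _ (add_mem (hrgp k) hx) _ fun t _ ↦ ?_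
  refine (Finset.single_le_sum (f := fun y ↦ N (y + x)) (fun _ _ ↦ Nat.zero_le _)
    (hfin.mem_toFinset.2 (hrb k))).trans (Nat.le_floor ?_)
  change (B : ℝ) ≤ _
  rw [div_le_iff₀ hε] at hk₀
  have h1 : (k₀ : ℝ) ≤ k := by exact_mod_cast hk
  have h2 : (k₀ : ℝ) * ε ≤ k * (c t + ε) :=
    mul_le_mul h1 (by have := hc t; linarith) hε.le (by positivity)
  linarith

end Lattice

end AffineMonoid

/-! ### The conditions (ii), (iii), (iv) and seminormality. -/

namespace AffineMonoid

open Set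

variable {m : ℕ}

variable {M : AddSubmonoid (Fin m → ℤ)} {F G : Set (Fin m → ℝ)}

theorem add_mem_relint_cn {x y : Fin m → ℝ} (hx : x ∈ relint (cn M)) (hy : y ∈ cn M) :
    x + y ∈ relint (cn M) := by
  rw [mem_relint_cn_iff] at hx ⊢
  refine ⟨add_mem_cn hx.1 hy, fun z hz ↦ ?_⟩
  obtain ⟨ε, hε, h⟩ := hx.2 z hz
  refine ⟨ε, hε, ?_⟩
  rw [add_sub_right_comm]
  exact add_mem_cn h hy

/-- The forms of facets not containing `F` are positive at `b`, so a large multiple of `b` repairs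
their sign; the other facets are covered by the hypothesis. -/
theorem IsFace.exists_add_smul_mem_cn (hM : M.FG) (hF : IsFace (cn M) F) {b x y : Fin m → ℝ}
    (hb : b ∈ relint F) (hy : y ∈ cn M) (hxy : x + y ∈ cn M)
    (h : ∀ β : (Fin m → ℝ) →ₗ[ℝ] ℝ, (∀ z ∈ cn M, 0 ≤ β z) →
      IsFacet (cn M) {z ∈ cn M | β z = 0} → F ⊆ {z ∈ cn M | β z = 0} → 0 ≤ β x) :
    ∃ k₀ : ℝ, 0 ≤ k₀ ∧ ∀ k ≥ k₀, x + k • b ∈ cn M := by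
  have hfin : {G | IsFacet (cn M) G}.Finite :=
    (finite_setOf_isFace hM).subset fun G hG ↦ hG.isFace
  choose! β hβ hβG using fun G (hG : IsFacet (cn M) G) ↦ hG.isFace
  have hbcn : b ∈ cn M := hF.subset (relint_subset _ hb)
  have hterm : ∀ G ∈ hfin.toFinset, 0 ≤ |β G x| / β G b := fun G hG ↦
    div_nonneg (abs_nonneg _) (hβ G (hfin.mem_toFinset.1 hG) _ hbcn)
  refine ⟨∑ G ∈ hfin.toFinset, |β G x| / β G b, Finset.sum_nonneg hterm, fun k hk ↦ ?_⟩
  have hk0 : 0 ≤ k := (Finset.sum_nonneg hterm).trans hk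
  refine mem_cn_of_facets_nonneg hM hy (by
    rw [add_right_comm]; exact add_mem_cn hxy (smul_mem_cn hk0 hbcn)) fun G hG ↦ ?_
  refine ⟨β G, hβ G hG, hβG G hG, ?_⟩
  rw [map_add, map_smul, smul_eq_mul]
  rcases (hβ G hG b hbcn).eq_or_lt with h0 | h0
  · have hbG : b ∈ G := by rw [hβG G hG]; exact ⟨hbcn, h0.symm⟩
    have := h (β G) (hβ G hG) (hβG G hG ▸ hG)
      (hβG G hG ▸ hF.subset_of_mem_relint hG.isFace hb hbG)
    rw [← h0]; linarith
  · have h1 := (Finset.single_le_sum hterm (hfin.mem_toFinset.2 hG)).trans hk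
    rw [div_le_iff₀ h0] at h1
    have := neg_abs_le (β G x)
    linarith

/-- A face is the intersection of the facets containing it. -/
theorem IsFace.mem_of_forall_isFacet (hM : M.FG) (hF : IsFace (cn M) F) {x : Fin m → ℝ}
    (hx : x ∈ cn M) (h : ∀ G, IsFacet (cn M) G → F ⊆ G → x ∈ G) : x ∈ F := by
  obtain ⟨b, hbM, hbF, hb⟩ := hF.exists_mem_relint hM
  -- Some `k • b - x` lies in the cone; adding `x` gives a point of `F`, hence `x ∈ F`.
  obtain ⟨k, hk0, hk⟩ := hF.exists_add_smul_mem_cn hM hb hx (x := -x)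
    (by rw [neg_add_cancel]; exact zero_mem_cn M) fun β hβ hG hFG ↦ by
      rw [map_neg, (h _ hG hFG).2, neg_zero]
  refine ((hF.add_mem_iff hx (hk k le_rfl)).1 ?_).1
  rw [add_neg_cancel_left]
  exact hF.smul_mem hk0 hbF

theorem subset_prime (M : AddSubmonoid (Fin m → ℤ)) : (M : Set (Fin m → ℤ)) ⊆ prime M :=
  fun a ha ↦ ⟨mem_gp_of_mem ha, fun G hG ↦ ⟨mem_gp_of_mem ha, 0, M.zero_mem, by
    rw [toReal_zero]; exact hG.isFace.zero_mem, by simpa using ha⟩⟩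

/-- A facet form vanishes at `b ∈ M ∩ G`, so `a + b ∈ M` makes it nonnegative at `a`. -/
theorem toReal_mem_cn_of_mem_prime (hM : M.FG) {a : Fin m → ℤ} (ha : a ∈ prime M) :
    toReal a ∈ cn M := by
  obtain ⟨p, hp, q, hq, hpq⟩ := mem_gp_iff.1 ha.1
  refine mem_cn_of_facets_nonneg hM (toReal_mem_cn hq) ?_ fun G hG ↦ ?_
  · rw [← toReal_add, hpq, sub_add_cancel]; exact toReal_mem_cn hp
  · obtain ⟨β, hβ, rfl⟩ := hG.isFace
    obtain ⟨-, b, -, hbG, hab⟩ := ha.2 _ hG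
    refine ⟨β, hβ, rfl, ?_⟩
    have := hβ _ (toReal_mem_cn hab)
    rwa [toReal_add, map_add, hbG.2, add_zero] at this

/-- A facet containing `x + b` contains `b`, so it is `G`; but it also contains `x`. -/
theorem IsFacet.add_mem_relint_cn (hM : M.FG) (hG : IsFacet (cn M) G) {x b : Fin m → ℝ}
    (hx : x ∈ cn M) (hxG : x ∉ G) (hb : b ∈ relint G) : x + b ∈ relint (cn M) := by
  have hbcn := hG.isFace.subset (relint_subset _ hb)
  refine mem_relint_cn_of_notMem_facets hM (add_mem_cn hx hbcn) fun H hH hxb ↦ ?_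
  obtain ⟨hxH, hbH⟩ := (hH.isFace.add_mem_iff hx hbcn).1 hxb
  obtain rfl := hG.eq_of_mem_relint hH hb hbH
  exact hxG hxH

theorem eq_prime_iff_interiorCondition (hM : M.FG) (hI : ContainsInterior M) :
    (M : Set (Fin m → ℤ)) = prime M ↔ InteriorCondition M := by
  constructor
  · intro h F hF
    ext a
    refine ⟨fun ⟨ha, har⟩ ↦ ⟨fun G _ hFG ↦ mem_gpInter_of_mem ha (hFG (relint_subset _ har)), har⟩,
      fun ⟨ha, har⟩ ↦ ⟨?_, har⟩⟩
    have haF := relint_subset _ har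
    change a ∈ (M : Set (Fin m → ℤ))
    rw [h]
    obtain ⟨G₀, hG₀, hFG₀⟩ := hF.exists_isFacet hM
    have hagp : a ∈ gp M := gpInter_le_gp _ _ (ha G₀ hG₀ hFG₀)
    refine ⟨hagp, fun G hG ↦ ⟨hagp, ?_⟩⟩
    by_cases hFG : F ⊆ G
    · obtain ⟨p, hp, -, q, hq, hqG, rfl⟩ := hG.isFace.mem_gpInter_iff.1 (ha G hG hFG)
      exact ⟨q, hq, hqG, by rwa [sub_add_cancel]⟩
    -- Here `a` is off `G`, so adding a point of `M` in the relative interior of `G` moves it into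
    -- the interior of the cone, where `hI` applies.
    · obtain ⟨b, hb, hbG, hbr⟩ := hG.isFace.exists_mem_relint hM
      refine ⟨b, hb, hbG, hI _ (add_mem hagp (mem_gp_of_mem hb)) ?_⟩
      rw [toReal_add]
      exact hG.add_mem_relint_cn hM (hF.1.subset haF)
        (fun haG ↦ hFG (hF.1.subset_of_mem_relint hG.isFace har haG)) hbr
  · intro h
    refine subset_antisymm (subset_prime M) fun a ha ↦ ?_
    obtain ⟨F, hF, haF⟩ := exists_isFace_mem_relint hM (toReal_mem_cn_of_mem_prime hM ha)
    by_cases hne : F = cn M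
    · exact hI a ha.1 (hne ▸ haF)
    · refine ((Set.ext_iff.1 (h F ⟨hF, hne⟩) a).2 ⟨fun G hG hFG ↦ ?_, haF⟩).1
      obtain ⟨-, b, hb, hbG, hab⟩ := ha.2 G hG
      refine hG.isFace.mem_gpInter_iff.2 ⟨a + b, hab, ?_, b, hb, hbG, by abel⟩
      rw [toReal_add]
      have haG := hFG (relint_subset _ haF)
      exact (hG.isFace.add_mem_iff (hG.isFace.subset haG) (hG.isFace.subset hbG)).2 ⟨haG, hbG⟩

/-- All large multiples of `a` lie in `M`. If all `k • a` with `k > n ≥ 1` do, so do `2n • a` and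
`3n • a`, hence `n • a`; descend to `n = 1`. -/
theorem IsSeminormal.containsInterior (hM : M.FG) (hs : IsSeminormal M) :
    ContainsInterior M := by
  intro a ha har
  obtain ⟨k₀, hk₀⟩ := exists_forall_nsmul_add_mem hM ha har (zero_mem _)
  simp only [add_zero] at hk₀
  have key : ∀ n : ℕ, (∀ k ≥ n + 1, k • a ∈ M) → a ∈ M := by
    intro n
    induction n with
    | zero => intro h; simpa using h 1 le_rfl
    | succ n ih =>
      intro h
      refine ih fun k hk ↦ ?_
      rcases hk.eq_or_lt with rfl | hk
      · refine hs _ (nsmul_mem ha _) ?_ ?_ <;> rw [← mul_nsmul'] <;> exact h _ (by omega)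
      · exact h k hk
  exact key k₀ fun k hk ↦ hk₀ k (by omega)

theorem IsFace.isSeminormal_interMonoid (hF : IsFace (cn M) F) (hs : IsSeminormal M) :
    IsSeminormal (interMonoid M F) := by
  intro z hz h2 h3
  rw [hF.mem_interMonoid] at h2 h3 ⊢
  have hzM := hs z (gpInter_le_gp _ _ (gp_interMonoid M F ▸ hz)) h2.1 h3.1
  refine ⟨hzM, ?_⟩
  have := h2.2
  rw [two_nsmul, toReal_add] at this
  exact ((hF.add_mem_iff (toReal_mem_cn hzM) (toReal_mem_cn hzM)).1 this).1

/-- From (iii) to (iv), a multiple of an element of `M` in the relative interior of `F` moves `a`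
into that interior, hence into `M`, and is then subtracted. Back, `M ∩ F` is seminormal with cone
`F`, so it contains the interior points of its group. -/
theorem interiorCondition_iff_groupCondition (hM : M.FG) (hs : IsSeminormal M) :
    InteriorCondition M ↔ GroupCondition M := by
  constructor
  · intro h F hF
    refine subset_antisymm (fun a ha G _ hFG ↦ gpInter_mono M hFG ha) fun a ha ↦ ?_
    obtain ⟨G₀, hG₀, hFG₀⟩ := hF.exists_isFacet hM
    obtain ⟨p, hp, q, hq, hpq⟩ := mem_gp_iff.1 (gpInter_le_gp _ _ (ha G₀ hG₀ hFG₀))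
    obtain ⟨b, hb, hbF, hbr⟩ := hF.1.exists_mem_relint hM
    have hβ0 : ∀ β : (Fin m → ℝ) →ₗ[ℝ] ℝ, IsFacet (cn M) {z ∈ cn M | β z = 0} →
        F ⊆ {z ∈ cn M | β z = 0} → β (toReal a) = 0 := by
      intro β hG hFG
      obtain ⟨p, hp, hpG, q, hq, hqG, rfl⟩ := hG.isFace.mem_gpInter_iff.1 (ha _ hG hFG)
      rw [toReal_sub, map_sub, hpG.2, hqG.2, sub_zero]
    obtain ⟨k₀, hk₀, hk⟩ := hF.1.exists_add_smul_mem_cn hM hbr (toReal_mem_cn hq)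
      (x := toReal a) (by rw [← toReal_add, hpq, sub_add_cancel]; exact toReal_mem_cn hp)
      fun β _ hG hFG ↦ (hβ0 β hG hFG).ge
    obtain ⟨k, hkk⟩ := exists_nat_ge k₀
    have hcF : toReal (a + k • b) ∈ F := by
      rw [toReal_add, toReal_nsmul]
      refine hF.1.mem_of_forall_isFacet hM (hk k hkk) fun G hG hFG ↦ ?_
      obtain ⟨β, hβ, rfl⟩ := hG.isFace
      refine ⟨hk k hkk, ?_⟩
      rw [map_add, map_smul, hβ0 β hG hFG, (hFG hbF).2]; simp
    have hcr : toReal (a + k • b + b) ∈ relint F := by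
      have h1 := hF.1.cn_interMonoid
      rw [toReal_add, add_comm]
      rw [← h1] at hbr hcF ⊢
      exact add_mem_relint_cn hbr hcF
    have hcM := ((Set.ext_iff.1 (h F hF) (a + k • b + b)).2 ⟨fun G hG hFG ↦ by
      have hbG := mem_gpInter_of_mem hb (hFG hbF)
      exact add_mem (add_mem (ha G hG hFG) (nsmul_mem hbG k)) hbG, hcr⟩).1
    have hbF' := mem_gpInter_of_mem hb hbF
    have : a = (a + k • b + b) - b - k • b := by abel
    rw [this]
    exact sub_mem (sub_mem (mem_gpInter_of_mem hcM (relint_subset _ hcr)) hbF') (nsmul_mem hbF' k)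
  · intro h F hF
    ext a
    refine ⟨fun ⟨ha, har⟩ ↦ ⟨fun G _ hFG ↦ mem_gpInter_of_mem ha (hFG (relint_subset _ har)), har⟩,
      fun ⟨ha, har⟩ ↦ ⟨?_, har⟩⟩
    have haF : a ∈ gpInter M F := (Set.ext_iff.1 (h F hF) a).2 ha
    refine (hF.1.mem_interMonoid.1 ((hF.1.isSeminormal_interMonoid hs).containsInterior
      (hF.1.interMonoid_fg hM) a ?_ ?_)).1
    · rwa [gp_interMonoid]
    · rwa [hF.1.cn_interMonoid]

/-- A proper submonoid of `M` whose complement absorbs `M` lies in a facet. -/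
theorem exists_isFacet_of_forall_add_mem (hM : M.FG) {N : Set (Fin m → ℤ)}
    (h0 : (0 : Fin m → ℤ) ∈ N)
    (hadd : ∀ a ∈ M, ∀ b ∈ M, a + b ∈ N ↔ a ∈ N ∧ b ∈ N) (hne : ∃ a ∈ M, a ∉ N) :
    ∃ G, IsFacet (cn M) G ∧ ∀ a ∈ M, a ∈ N → toReal a ∈ G := by
  classical
  obtain ⟨T, hT⟩ := id hM
  have hTM : ∀ t ∈ T, t ∈ M := fun t ht ↦ hT ▸ AddSubmonoid.subset_closure ht
  obtain ⟨U, hU⟩ : ∃ U : Finset (Fin m → ℤ), ∀ t, t ∈ U ↔ t ∈ T ∧ t ∈ N :=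
    ⟨T.filter (· ∈ N), fun _ ↦ Finset.mem_filter⟩
  -- A face containing this sum contains every generator in `N`. The sum is not interior: otherwise
  -- `k • n - a ∈ M` for some `k`, and `k • n ∈ N` would force `a ∈ N`.
  let n : Fin m → ℤ := ∑ t ∈ U, t
  have hsum : ∀ S ⊆ T, (∀ t ∈ S, t ∈ N) → ∑ t ∈ S, t ∈ M ∧ ∑ t ∈ S, t ∈ N := by
    intro S
    induction S using Finset.induction_on with
    | empty => intro _ _; exact ⟨by simp, by simpa using h0⟩
    | insert t S ht ih =>
      intro hS hN
      obtain ⟨h1, h2⟩ := ih ((Finset.subset_insert _ _).trans hS) fun t ht ↦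
        hN t (Finset.mem_insert_of_mem ht)
      have htM := hTM t (hS (Finset.mem_insert_self _ _))
      rw [Finset.sum_insert ht]
      exact ⟨add_mem htM h1, (hadd _ htM _ h1).2 ⟨hN t (Finset.mem_insert_self _ _), h2⟩⟩
  obtain ⟨hnM, hnN⟩ : n ∈ M ∧ n ∈ N :=
    hsum _ (fun t ht ↦ ((hU t).1 ht).1) fun t ht ↦ ((hU t).1 ht).2
  have hnr : toReal n ∉ relint (cn M) := by
    intro hnr
    obtain ⟨a, haM, haN⟩ := hne
    obtain ⟨k, hk⟩ := exists_forall_nsmul_add_mem hM (mem_gp_of_mem hnM) hnr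
      (neg_mem (mem_gp_of_mem haM))
    have h1 := hk k le_rfl
    have h2 : ∀ k : ℕ, k • n ∈ N := fun k ↦ by
      induction k with
      | zero => simpa using h0
      | succ k ih => rw [succ_nsmul]; exact (hadd _ (nsmul_mem hnM k) _ hnM).2 ⟨ih, hnN⟩
    refine haN ((hadd _ h1 _ haM).1 ?_).2
    rw [neg_add_cancel_right]
    exact h2 k
  obtain ⟨F, hF, hnF⟩ := exists_isProperFace_of_notMem_relint hM (toReal_mem_cn hnM) hnr
  obtain ⟨G, hG, hFG⟩ := hF.exists_isFacet hM
  refine ⟨G, hG, fun a haM haN ↦ ?_⟩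
  have hgen : ∀ t ∈ T, t ∈ N → toReal t ∈ G := by
    intro t ht htN
    have : t + ∑ s ∈ U.erase t, s = n := Finset.add_sum_erase U (fun s ↦ s) ((hU t).2 ⟨ht, htN⟩)
    have hmem := hFG hnF
    rw [← this, toReal_add, hG.isFace.add_mem_iff (toReal_mem_cn (hTM t ht))] at hmem
    · exact hmem.1
    · exact toReal_mem_cn (sum_mem fun s hs ↦
        hTM s ((hU s).1 (Finset.mem_of_mem_erase hs)).1)
  clear hne
  rw [← hT] at haM
  induction haM using AddSubmonoid.closure_induction with
  | mem x hx => exact hgen x hx haN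
  | zero => rw [toReal_zero]; exact hG.isFace.zero_mem
  | add x y hx hy ihx ihy =>
    rw [hT] at hx hy
    rw [hadd _ hx _ hy] at haN
    rw [toReal_add, hG.isFace.add_mem_iff (toReal_mem_cn hx) (toReal_mem_cn hy)]
    exact ⟨ihx haN.1, ihy haN.2⟩

end AffineMonoid

/-! ### Serre's condition `(S₂)` for Noetherian domains. -/

namespace Serre

open Set IsLocalRing RingTheory.Sequence
open scoped Pointwise

variable {R : Type*} [CommRing R]

theorem depth_congr {A N N' : Type*} [CommRing A] [IsLocalRing A] [AddCommGroup N] [Module A N]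
    [AddCommGroup N'] [Module A N'] (e : N ≃ₗ[A] N') : depth A N = depth A N' := by
  simp only [depth, e.isRegular_congr]

theorem le_depth {A N : Type*} [CommRing A] [IsLocalRing A] [AddCommGroup N] [Module A N]
    {rs : List A} (h : IsRegular N rs) (hrs : ∀ r ∈ rs, r ∈ maximalIdeal A) :
    (rs.length : ℕ∞) ≤ depth A N :=
  le_iSup_of_le rs (le_iSup_of_le h (le_iSup_of_le hrs le_rfl))

/-- The localization of the regular module, as a module over the localized ring. -/
noncomputable def localizedModuleSelfEquiv (p : Ideal R) [p.IsPrime] :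
    LocalizedModule.AtPrime p R ≃ₗ[Localization.AtPrime p] Localization.AtPrime p :=
  (IsLocalizedModule.linearEquiv p.primeCompl (LocalizedModule.mkLinearMap p.primeCompl R)
    (Algebra.linearMap R (Localization.AtPrime p))).extendScalarsOfIsLocalization
      p.primeCompl (Localization.AtPrime p)

theorem satisfiesS_self_iff (k : ℕ) : SatisfiesS k R R ↔ ∀ (p : Ideal R) [p.IsPrime],
    min (k : ℕ∞) p.height ≤ depth (Localization.AtPrime p) (Localization.AtPrime p) := by
  refine forall_congr' fun p ↦ forall_congr' fun _ ↦ ?_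
  rw [depth_congr (localizedModuleSelfEquiv p),
    Module.supportDim_eq_of_equiv (localizedModuleSelfEquiv p),
    Module.supportDim_self_eq_ringKrullDim, IsLocalization.AtPrime.ringKrullDim_eq_height p,
    ← WithBot.coe_min, WithBot.coe_le_coe]

theorem mk_eq_zero_iff_dvd {b c : R} :
    (Submodule.Quotient.mk c : QuotSMulTop b R) = 0 ↔ b ∣ c := by
  rw [Submodule.Quotient.mk_eq_zero, Submodule.mem_smul_pointwise_iff_exists]
  simp [dvd_def, eq_comm]

theorem isSMulRegular_quotSMulTop_iff {b s : R} :
    IsSMulRegular (QuotSMulTop b R) s ↔ ∀ c, b ∣ s * c → b ∣ c := by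
  rw [isSMulRegular_iff_right_eq_zero_of_smul]
  refine ⟨fun h c hc ↦ ?_, fun h x hx ↦ ?_⟩
  · exact mk_eq_zero_iff_dvd.1 (h (Submodule.Quotient.mk c) (mk_eq_zero_iff_dvd.2 hc))
  · obtain ⟨c, rfl⟩ := Submodule.Quotient.mk_surjective _ x
    exact mk_eq_zero_iff_dvd.2 (h c (mk_eq_zero_iff_dvd.1 hx))

/-- In a local domain of depth at least two, a fraction multiplied into the ring by the maximal
ideal belongs to the ring. -/
theorem dvd_of_one_lt_depth {A : Type*} [CommRing A] [IsLocalRing A] [IsDomain A]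
    (hA : 1 < depth A A) {b c : A} (hb : b ≠ 0) (h : ∀ r ∈ maximalIdeal A, b ∣ r * c) : b ∣ c := by
  simp only [depth, lt_iSup_iff] at hA
  obtain ⟨rs, hrs, hmem, hlen⟩ := hA
  match rs, hrs, hmem, hlen with
  | [], _, _, hlen => simp at hlen
  | [_], _, _, hlen => simp at hlen
  | r :: s :: rs, hrs, hmem, _ =>
    obtain ⟨u, hu⟩ := h r (hmem r (by simp))
    obtain ⟨v, hv⟩ := h s (hmem s (by simp))
    have hw := hrs.toIsWeaklyRegular
    rw [isWeaklyRegular_cons_iff, isWeaklyRegular_cons_iff] at hw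
    have hr : r ≠ 0 := by
      rintro rfl
      exact one_ne_zero (hw.1 (by simp : (0 : A) • (1 : A) = (0 : A) • (0 : A)))
    -- As `s` is regular modulo `r`, this gives `r ∣ u`, and `r` cancels from `r * c = b * u`.
    have hsu : s * u = r * v := mul_left_cancel₀ hb (by linear_combination r * hv - s * hu)
    obtain ⟨w, rfl⟩ := isSMulRegular_quotSMulTop_iff.1 hw.2.1 u ⟨v, hsu⟩
    exact ⟨w, mul_left_cancel₀ hr (by linear_combination hu)⟩

/-- The fraction `c / b` maps the finitely generated nonzero module `J` into itself, so it is
integral (the determinant trick). -/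
theorem dvd_of_forall_mem_ideal [IsDomain R] [IsIntegrallyClosed R] {J : Ideal R}
    (hJ : J.FG) (hJ0 : J ≠ ⊥)
    {b c : R} (hb : b ≠ 0) (h : ∀ q ∈ J, ∃ u ∈ J, q * c = b * u) : b ∣ c := by
  let f := algebraMap R (FractionRing R)
  have hinj : Function.Injective f := IsFractionRing.injective R (FractionRing R)
  have hfb : f b ≠ 0 := (map_ne_zero_iff _ hinj).2 hb
  have hint : IsIntegral R (f c / f b) := by
    refine isIntegral_of_smul_mem_submodule (M := FractionRing R)
      (Submodule.map (Algebra.linearMap R (FractionRing R)) J) ?_ (Submodule.FG.map _ hJ) _ ?_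
    · rw [← Submodule.map_bot (Algebra.linearMap R (FractionRing R))]
      exact (Submodule.map_injective_of_injective
        (f := Algebra.linearMap R (FractionRing R)) hinj).ne hJ0
    · rintro _ ⟨q, hq, rfl⟩
      obtain ⟨u, hu, hqu⟩ := h q hq
      refine ⟨u, hu, ?_⟩
      change f u = f c / f b * f q
      rw [div_mul_eq_mul_div, eq_div_iff hfb, ← map_mul, ← map_mul]
      congr 1
      linear_combination -hqu
  obtain ⟨z, hz⟩ := IsIntegrallyClosed.isIntegral_iff.1 hint
  refine ⟨z, hinj ?_⟩
  rw [map_mul]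
  change algebraMap R (FractionRing R) z = _ at hz
  rw [hz, mul_div_cancel₀ _ hfb]

theorem isAssociatedPrime_quotSMulTop_iff [IsNoetherianRing R] {b : R} {Q : Ideal R} :
    IsAssociatedPrime Q (QuotSMulTop b R) ↔ Q.IsPrime ∧ ∃ c, ∀ r, r ∈ Q ↔ b ∣ r * c := by
  rw [isAssociatedPrime_iff]
  refine and_congr_right fun _ ↦ ?_
  rw [(Submodule.Quotient.mk_surjective _).exists]
  refine exists_congr fun c ↦ ?_
  simp only [Ideal.ext_iff, Submodule.mem_colon_singleton, Submodule.mem_bot]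
  exact forall_congr' fun r ↦ by rw [← Submodule.Quotient.mk_smul, mk_eq_zero_iff_dvd, smul_eq_mul]

theorem exists_isPrime_forall_mem_iff_dvd [IsNoetherianRing R] {b c : R} (h : ¬ b ∣ c) :
    ∃ Q : Ideal R, Q.IsPrime ∧ (∀ r, b ∣ r * c → r ∈ Q) ∧ ∃ c', ∀ r, r ∈ Q ↔ b ∣ r * c' := by
  obtain ⟨Q, hQ, hle⟩ := exists_le_isAssociatedPrime_of_isNoetherianRing R
    (Submodule.Quotient.mk c : QuotSMulTop b R) (by rwa [Ne, mk_eq_zero_iff_dvd])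
  obtain ⟨h1, h2⟩ := isAssociatedPrime_quotSMulTop_iff.1 hQ
  refine ⟨Q, h1, fun r hr ↦ hle ?_, h2⟩
  rw [Submodule.mem_colon_singleton, Submodule.mem_bot]
  exact mk_eq_zero_iff_dvd.2 hr

variable [IsDomain R] [IsNoetherianRing R]

/-- A Noetherian domain satisfies `(S₂)` iff the primes associated to its nonzero principal ideals
have height at most one. -/
theorem satisfiesS_two_iff : SatisfiesS 2 R R ↔ ∀ (b c : R) (Q : Ideal R) [Q.IsPrime], b ≠ 0 →
    (∀ r, r ∈ Q ↔ b ∣ r * c) → Q.height ≤ 1 := by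
  rw [satisfiesS_self_iff]
  constructor
  · intro h b c Q _ hb hQ
    by_contra! hht
    have hd : 1 < depth (Localization.AtPrime Q) (Localization.AtPrime Q) := by
      refine lt_of_lt_of_le ?_ (h Q)
      exact lt_min (by norm_num) hht
    have hinj := IsLocalization.injective (Localization.AtPrime Q) Q.primeCompl_le_nonZeroDivisors
    have hdvd : algebraMap R (Localization.AtPrime Q) b ∣ algebraMap R _ c := by
      refine dvd_of_one_lt_depth hd ((map_ne_zero_iff _ hinj).2 hb) fun r hr ↦ ?_
      rw [← Localization.AtPrime.map_eq_maximalIdeal] at hr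
      induction hr using Submodule.span_induction with
      | mem x hx =>
        obtain ⟨r, hr, rfl⟩ := hx
        rw [← map_mul]
        exact map_dvd _ ((hQ r).1 hr)
      | zero => simp
      | add x y _ _ hx hy => rw [add_mul]; exact dvd_add hx hy
      | smul a x _ hx => rw [smul_eq_mul, mul_assoc]; exact hx.mul_left a
    obtain ⟨w, hw⟩ := hdvd
    obtain ⟨⟨w, t⟩, rfl⟩ := IsLocalization.mk'_surjective Q.primeCompl w
    refine t.2 ((hQ t).2 ⟨w, hinj ?_⟩)
    rw [map_mul, map_mul, hw, mul_left_comm, IsLocalization.mk'_spec']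
  · intro h p _
    by_cases hp : p = ⊥
    · subst hp; simp
    obtain ⟨b, hbp, hb⟩ := Submodule.exists_mem_ne_zero_of_ne_bot hp
    have hbreg : IsSMulRegular R b := fun x y hxy ↦ mul_left_cancel₀ hb hxy
    have key : ∀ rs : List R, IsWeaklyRegular R rs → (∀ r ∈ rs, r ∈ p) →
        (rs.length : ℕ∞) ≤ depth (Localization.AtPrime p) (Localization.AtPrime p) := by
      intro rs hrs hmem
      have := le_depth (hrs.isRegular_of_isLocalization_of_mem (Localization.AtPrime p) p hmem)
        fun r hr ↦ by
          obtain ⟨r, hr', rfl⟩ := List.mem_map.1 hr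
          exact (IsLocalization.AtPrime.to_map_mem_maximal_iff _ p r).2 (hmem r hr')
      simpa using this
    rcases le_or_gt p.height 1 with hht | hht
    · refine (min_le_right _ _).trans (hht.trans ?_)
      simpa using key [b] ((isWeaklyRegular_singleton_iff _ _).2 hbreg) (by simpa)
    · refine (min_le_left _ _).trans ?_
      -- Prime avoidance: otherwise `p` lies in an associated prime of `R / b`, of height at most
      -- one.
      obtain ⟨s, hsp, hs⟩ : ∃ s ∈ p, IsSMulRegular (QuotSMulTop b R) s := by
        by_contra! hcon
        have hsub : (p : Set R) ⊆ ⋃ Q ∈ associatedPrimes R (QuotSMulTop b R), Q := by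
          rw [biUnion_associatedPrimes_eq_compl_regular]
          exact fun s hs ↦ hcon s hs
        obtain ⟨Q, hQ, hle⟩ := (p.subset_union_prime_finite (associatedPrimes.finite ..)
          (f := id) 0 0 fun _ h _ _ ↦ h.1).1 hsub
        obtain ⟨hQp, c, hc⟩ := isAssociatedPrime_quotSMulTop_iff.1 hQ
        exact ((Ideal.height_mono hle).trans (h b c Q hb hc)).not_gt hht
      have := key [b, s] (by
        rw [isWeaklyRegular_cons_iff, isWeaklyRegular_singleton_iff]
        exact ⟨hbreg, hs⟩) (by simp [hbp, hsp])
      simpa using this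

/-- If `u ∉ Q`, the relations `q' * u = q * u'` for `q' ∈ Q` show that `Q` is minimal over `(q)`,
against Krull's principal ideal theorem. -/
theorem mem_of_mul_eq_mul_of_one_lt_height {b c : R} {Q : Ideal R} [Q.IsPrime] (hb : b ≠ 0)
    (hQ : ∀ r, r ∈ Q ↔ b ∣ r * c) (hht : 1 < Q.height) {q u : R} (hq : q ∈ Q)
    (hu : q * c = b * u) : u ∈ Q := by
  by_contra huQ
  refine hht.not_ge (Ideal.height_le_one_of_isPrincipal_of_mem_minimalPrimes (Ideal.span {q}) Q
    ⟨⟨inferInstance, by simpa [Ideal.span_le]⟩, fun J ⟨hJ, hqJ⟩ hJQ q' hq' ↦ ?_⟩)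
  obtain ⟨u', hu'⟩ := (hQ q').1 hq'
  have : q' * u = q * u' := mul_left_cancel₀ hb (by linear_combination q * hu' - q' * hu)
  have hmem : q' * u ∈ J := this ▸ J.mul_mem_right _ (hqJ (Ideal.mem_span_singleton_self q))
  exact (hJ.mem_or_mem hmem).resolve_right fun h ↦ huQ (hJQ h)

end Serre

/-! ### Laurent polynomials and supports. -/

namespace AddMonoidAlgebra

variable {K : Type*} [Field K]

section Laurent

variable (m : ℕ)

/-- The inclusion of `ℕ^m` into `ℤ^m`. -/
noncomputable def natToInt : (Fin m →₀ ℕ) →+ (Fin m → ℤ) where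
  toFun s i := (s i : ℤ)
  map_zero' := by ext; simp
  map_add' s t := by ext; simp

theorem natToInt_injective : Function.Injective (natToInt m) := fun s t h ↦ by
  ext i
  exact Nat.cast_injective (R := ℤ) (congrFun h i)

/-- The monomials of the polynomial ring. -/
noncomputable def monomials (K : Type*) [Field K] : Submonoid (AddMonoidAlgebra K (Fin m →₀ ℕ)) :=
  MonoidHom.mrange (AddMonoidAlgebra.of K (Fin m →₀ ℕ))

theorem single_mem_monomials (s : Fin m →₀ ℕ) :
    (single s 1 : AddMonoidAlgebra K (Fin m →₀ ℕ)) ∈ monomials m K := ⟨Multiplicative.ofAdd s, rfl⟩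

theorem isLocalization_monomials :
    letI := (mapDomainRingHom K (natToInt m)).toAlgebra
    IsLocalization (monomials m K) (AddMonoidAlgebra K (Fin m → ℤ)) := by
  let := (mapDomainRingHom K (natToInt m)).toAlgebra
  have halg : ∀ x, algebraMap (AddMonoidAlgebra K (Fin m →₀ ℕ)) (AddMonoidAlgebra K (Fin m → ℤ)) x =
    mapDomain (natToInt m) x := fun x ↦ rfl
  refine (isLocalization_iff _ _).2 ⟨?_, ?_, ?_⟩
  · rintro ⟨_, s, rfl⟩
    change IsUnit (mapDomain (natToInt m) (single s.toAdd 1))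
    rw [mapDomain_single]
    refine IsUnit.of_mul_eq_one (single (- natToInt m s.toAdd) 1) ?_
    rw [single_mul_single, add_neg_cancel, mul_one, one_def]
  · intro z
    induction z using induction_linear with
    | zero => exact ⟨(0, 1), by simp⟩
    | add x y hx hy =>
      obtain ⟨⟨x', s⟩, hx⟩ := hx
      obtain ⟨⟨y', t⟩, hy⟩ := hy
      refine ⟨(x' * t + y' * s, s * t), ?_⟩
      simp only [Submonoid.coe_mul, map_mul, map_add] at hx hy ⊢
      rw [← hx, ← hy]; ring
    | single a r =>
      refine ⟨(single (Finsupp.equivFunOnFinite.symm fun i ↦ (a i).toNat) r,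
        ⟨_, single_mem_monomials m (Finsupp.equivFunOnFinite.symm fun i ↦ (-a i).toNat)⟩), ?_⟩
      simp only [halg, mapDomain_single, single_mul_single, mul_one]
      congr 1
      ext i
      simp [natToInt]
      omega
  · intro x y h
    exact ⟨1, by rw [mapDomain_injective (natToInt_injective m) h]⟩

/-- The Laurent polynomial ring is the localization of a polynomial ring at its monomials. -/
instance isIntegrallyClosed_laurent :
    IsIntegrallyClosed (AddMonoidAlgebra K (Fin m → ℤ)) := by
  let := (mapDomainRingHom K (natToInt m)).toAlgebra
  have := isLocalization_monomials (K := K) m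
  have : IsIntegrallyClosed (AddMonoidAlgebra K (Fin m →₀ ℕ)) :=
    inferInstanceAs (IsIntegrallyClosed (MvPolynomial (Fin m) K))
  refine isIntegrallyClosed_of_isLocalization _ (monomials m K) ?_
  rintro _ ⟨s, rfl⟩
  exact mem_nonZeroDivisors_of_ne_zero (single_ne_zero.2 one_ne_zero)

end Laurent

section Support

variable {A : Type*}

/-- The exponents of `z` lie in `S`. -/
def SupportedIn (S : Set A) (z : AddMonoidAlgebra K A) : Prop := ∀ a, z.coeff a ≠ 0 → a ∈ S

variable {S T U : Set A} {x y z : AddMonoidAlgebra K A}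

theorem SupportedIn.mono (hz : SupportedIn S z) (h : S ⊆ T) : SupportedIn T z :=
  fun a ha ↦ h (hz a ha)

theorem SupportedIn.mul [AddCommGroup A] (hx : SupportedIn S x) (hy : SupportedIn T y)
    (h : ∀ s ∈ S, ∀ t ∈ T, s + t ∈ U) : SupportedIn U (x * y) := by
  classical
  intro a ha
  obtain ⟨s, hs, t, ht, rfl⟩ := Finset.mem_add.1
    (support_coeff_mul_subset x y (Finsupp.mem_support_iff.2 ha))
  exact h s (hx s (Finsupp.mem_support_iff.1 hs)) t (hy t (Finsupp.mem_support_iff.1 ht))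

theorem SupportedIn.coeff_eq_zero_of_notMem (hz : SupportedIn S z) {a : A} (ha : a ∉ S) :
    z.coeff a = 0 :=
  not_not.1 (not_imp_not.2 (hz a) ha)

theorem SupportedIn.exists_add (hz : SupportedIn T z) (S : Set A) :
    ∃ x y, z = x + y ∧ SupportedIn (T ∩ S) x ∧ SupportedIn (T \ S) y ∧
      ∀ a ∈ S, x.coeff a = z.coeff a := by
  classical
  refine ⟨.ofCoeff (z.coeff.filter (· ∈ S)), .ofCoeff (z.coeff.filter (· ∉ S)), ?_, ?_, ?_, ?_⟩
  · rw [← ofCoeff_add, Finsupp.filter_add_filter_not, ofCoeff_coeff]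
  · intro a ha
    by_cases haS : a ∈ S
    · rw [coeff_ofCoeff, Finsupp.filter_apply_pos _ _ haS] at ha
      exact ⟨hz a ha, haS⟩
    · exact absurd (Finsupp.filter_apply_neg _ _ haS) ha
  · intro a ha
    by_cases haS : a ∈ S
    · exact absurd (Finsupp.filter_apply_neg (· ∉ S) _ (not_not.2 haS)) ha
    · rw [coeff_ofCoeff, Finsupp.filter_apply_pos (· ∉ S) _ haS] at ha
      exact ⟨hz a ha, haS⟩
  · intro a ha
    exact Finsupp.filter_apply_pos _ _ ha

/-- If the lowest part `h₀` of `h₀ + h₁` (with respect to a weight `w`) has exponents which preserve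
both `S` and its complement, then `(h₀ + h₁) * z` has exponents in `S` only if `z` does. -/
theorem SupportedIn.of_mul [AddCommGroup A] [NoZeroDivisors (AddMonoidAlgebra K A)]
    (w : A →+ ℝ) {H₀ H₁ : Set A}
    {h₀ h₁ : AddMonoidAlgebra K A} (h₀0 : h₀ ≠ 0) (hh₀ : SupportedIn H₀ h₀)
    (hh₁ : SupportedIn H₁ h₁) (hw₀ : ∀ k ∈ H₀, w k = 0) (hw₁ : ∀ k ∈ H₁, 0 < w k)
    (hS₀ : ∀ k ∈ H₀, ∀ s, k + s ∈ S ↔ s ∈ S) (hS₁ : ∀ k ∈ H₁, ∀ s ∈ S, k + s ∈ S)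
    (hz : SupportedIn S ((h₀ + h₁) * z)) : SupportedIn S z := by
  classical
  obtain ⟨z₁, z₂, rfl, hz₁, hz₂, -⟩ := SupportedIn.exists_add (T := Set.univ) (z := z)
    (fun _ _ ↦ trivial) S
  suffices h : z₂ = 0 by
    rw [h, add_zero]; exact hz₁.mono Set.inter_subset_right
  by_contra hne
  obtain ⟨d, hd, hmin⟩ := z₂.coeff.support.exists_min_image w
    (Finsupp.support_nonempty_iff.2 (coeff_eq_zero.not.2 hne))
  have hz₂' : SupportedIn {s | s ∉ S ∧ w d ≤ w s} z₂ := fun a ha ↦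
    ⟨(hz₂ a ha).2, hmin a (Finsupp.mem_support_iff.2 ha)⟩
  obtain ⟨z₃, z₄, h34, hz₃, hz₄, hcoeff⟩ := hz₂'.exists_add {s | w s = w d}
  have hz₃0 : z₃ ≠ 0 := by
    rintro rfl
    exact Finsupp.mem_support_iff.1 hd (by rw [← hcoeff d rfl]; simp)
  -- Here `z₃` is the lowest-weight part of `z` outside `S`. The exponent `e` of `h₀ * z₃` is
  -- outside `S` and of weight `w d`; every other term of the product has exponents in `S` or of
  -- larger weight, so nothing cancels it.
  obtain ⟨e, he⟩ := Finsupp.ne_iff.1 (coeff_eq_zero.not.2 (mul_ne_zero h₀0 hz₃0))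
  rw [Finsupp.coe_zero, Pi.zero_apply] at he
  have heS : e ∈ {s | s ∉ S ∧ w s = w d} := by
    refine (hh₀.mul hz₃ ?_) e he
    rintro s hs t ⟨⟨ht, -⟩, htd⟩
    exact ⟨(hS₀ s hs t).not.2 ht, by rw [map_add, hw₀ s hs, zero_add]; exact htd⟩
  have e1 : (h₀ * z₁).coeff e = 0 := (hh₀.mul hz₁ (U := S) fun s hs t ht ↦
    (hS₀ s hs t).2 ht.2).coeff_eq_zero_of_notMem heS.1
  have e2 : (h₁ * z₁).coeff e = 0 := (hh₁.mul hz₁ (U := S) fun s hs t ht ↦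
    hS₁ s hs t ht.2).coeff_eq_zero_of_notMem heS.1
  have e3 : (h₀ * z₄).coeff e = 0 := by
    refine (hh₀.mul hz₄ (U := {s | w d < w s}) ?_).coeff_eq_zero_of_notMem (by
      rw [Set.mem_ofPred_eq, not_lt]; exact heS.2.le)
    rintro s hs t ⟨⟨-, ht⟩, htd⟩
    rw [Set.mem_ofPred_eq, map_add, hw₀ s hs, zero_add]
    exact lt_of_le_of_ne ht (Ne.symm htd)
  have e4 : (h₁ * z₂).coeff e = 0 := by
    refine (hh₁.mul hz₂' (U := {s | w d < w s}) ?_).coeff_eq_zero_of_notMem (by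
      rw [Set.mem_ofPred_eq, not_lt]; exact heS.2.le)
    rintro s hs t ⟨-, ht⟩
    have := hw₁ s hs
    rw [Set.mem_ofPred_eq, map_add]; linarith
  have hexp : (h₀ + h₁) * (z₁ + z₂) = h₀ * z₃ + h₀ * z₁ + h₁ * z₁ + h₀ * z₄ + h₁ * z₂ := by
    rw [add_mul, mul_add, mul_add]
    conv_lhs => rw [h34, mul_add]
    rw [← h34]; abel
  have := hz.coeff_eq_zero_of_notMem heS.1
  rw [hexp] at this
  simp only [coeff_add, Finsupp.add_apply, e1, e2, e3, e4, add_zero] at this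
  exact he this

end Support

end AddMonoidAlgebra

/-! ### Monomial primes and the equivalence of (i) and (ii). -/

namespace AffineMonoid

open AddMonoidAlgebra

variable {m : ℕ} {M : AddSubmonoid (Fin m → ℤ)} {F G : Set (Fin m → ℝ)} {K : Type*} [Field K]

section Embedding

/-- The inclusion of the monoid algebra into the Laurent polynomial ring. -/
noncomputable def toLaurent (M : AddSubmonoid (Fin m → ℤ)) (K : Type*) [Field K] :
    AddMonoidAlgebra K M →+* AddMonoidAlgebra K (Fin m → ℤ) :=
  mapDomainRingHom K M.subtype

theorem toLaurent_injective : Function.Injective (toLaurent M K) :=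
  mapDomain_injective Subtype.val_injective

theorem toLaurent_single (a : M) (r : K) :
    toLaurent M K (single a r) = single (a : Fin m → ℤ) r := mapDomain_single

theorem coeff_toLaurent (f : AddMonoidAlgebra K M) (a : M) :
    (toLaurent M K f).coeff a = f.coeff a :=
  Finsupp.mapDomain_apply Subtype.val_injective _ _

theorem supportedIn_toLaurent (f : AddMonoidAlgebra K M) {S : Set (Fin m → ℤ)}
    (hS : ∀ a : M, f.coeff a ≠ 0 → (a : Fin m → ℤ) ∈ S) : SupportedIn S (toLaurent M K f) := by
  intro a ha
  by_cases haM : a ∈ M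
  · exact hS ⟨a, haM⟩ (by rwa [← coeff_toLaurent])
  · exact absurd (Finsupp.mapDomain_of_notMem_range _ _ (by simpa using haM)) ha

theorem exists_toLaurent_eq {z : AddMonoidAlgebra K (Fin m → ℤ)}
    (hz : SupportedIn (M : Set (Fin m → ℤ)) z) : ∃ f, toLaurent M K f = z := by
  refine ⟨z.comapDomain Subtype.val Subtype.val_injective, mapDomain_comapDomain (fun a ha ↦ ?_) _⟩
  exact ⟨⟨a, hz a (Finsupp.mem_support_iff.1 ha)⟩, rfl⟩

instance : IsDomain (AddMonoidAlgebra K M) :=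
  have : IsDomain (AddMonoidAlgebra K (Fin m → ℤ)) := NoZeroDivisors.to_isDomain _
  toLaurent_injective.isDomain (toLaurent M K)

theorem isNoetherianRing_addMonoidAlgebra (hM : M.FG) :
    IsNoetherianRing (AddMonoidAlgebra K M) := by
  have : AddMonoid.FG M := (AddMonoid.fg_iff_addSubmonoid_fg M).2 hM
  exact Algebra.FiniteType.isNoetherianRing K _

theorem single_mul_single_one (a b : M) :
    (single a 1 * single b 1 : AddMonoidAlgebra K M) = single (a + b) 1 := by
  rw [single_mul_single, one_mul]

end Embedding

section FacePrime

open Classical in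
/-- The projection of `K[M]` onto `K[M ∩ F]`, as an endomorphism of `K[M]`. -/
noncomputable def faceProj (K : Type*) [Field K] (hF : IsFace (cn M) F) :
    AddMonoidAlgebra K M →ₐ[K] AddMonoidAlgebra K M :=
  AddMonoidAlgebra.lift K (AddMonoidAlgebra K M) M
    { toFun a := if toReal (a.toAdd : Fin m → ℤ) ∈ F then single a.toAdd 1 else 0
      map_one' := by
        simp [toReal_zero, hF.zero_mem, one_def]
      map_mul' a b := by
        simp only [toAdd_mul, AddSubmonoid.coe_add, toReal_add,
          hF.add_mem_iff (toReal_mem_cn a.toAdd.2) (toReal_mem_cn b.toAdd.2), ite_and]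
        split_ifs <;> simp [single_mul_single] }

open Classical in
theorem faceProj_single (hF : IsFace (cn M) F) (a : M) (r : K) :
    faceProj K hF (single a r) = if toReal (a : Fin m → ℤ) ∈ F then single a r else 0 := by
  rw [faceProj, lift_single]
  simp

open Classical in
theorem coeff_faceProj (hF : IsFace (cn M) F) (f : AddMonoidAlgebra K M) (a : M) :
    (faceProj K hF f).coeff a = if toReal (a : Fin m → ℤ) ∈ F then f.coeff a else 0 := by
  induction f using induction_linear with
  | zero => simp
  | add x y hx hy => rw [map_add, coeff_add, Finsupp.add_apply, hx, hy]; split_ifs <;> simp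
  | single b r =>
    rw [faceProj_single]
    by_cases hab : b = a
    · subst hab; split_ifs <;> simp
    · split_ifs <;> simp [hab]

/-- The prime ideal spanned by the monomials outside a face. -/
noncomputable def facePrime (K : Type*) [Field K] (hF : IsFace (cn M) F) :
    Ideal (AddMonoidAlgebra K M) := RingHom.ker (faceProj K hF)

instance (hF : IsFace (cn M) F) : (facePrime K hF).IsPrime := RingHom.ker_isPrime _

theorem mem_facePrime (hF : IsFace (cn M) F) {f : AddMonoidAlgebra K M} :
    f ∈ facePrime K hF ↔ ∀ a : M, f.coeff a ≠ 0 → toReal (a : Fin m → ℤ) ∉ F := by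
  classical
  rw [facePrime, RingHom.mem_ker, ← coeff_eq_zero, Finsupp.ext_iff]
  refine forall_congr' fun a ↦ ?_
  change (faceProj K hF f).coeff a = 0 ↔ _
  rw [coeff_faceProj]
  split_ifs with h <;> simp [h]

theorem single_mem_facePrime (hF : IsFace (cn M) F) {a : M} :
    (single a 1 : AddMonoidAlgebra K M) ∈ facePrime K hF ↔ toReal (a : Fin m → ℤ) ∉ F := by
  classical
  rw [facePrime, RingHom.mem_ker]
  rw [faceProj_single]
  split_ifs with h <;> simp [h]

theorem facePrime_le (hF : IsFace (cn M) F) {J : Ideal (AddMonoidAlgebra K M)}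
    (h : ∀ a : M, toReal (a : Fin m → ℤ) ∉ F → single a 1 ∈ J) : facePrime K hF ≤ J := by
  intro f hf
  rw [mem_facePrime] at hf
  rw [← sum_coeff_single f]
  refine Ideal.sum_mem _ fun a ha ↦ ?_
  have : (single a (f.coeff a) : AddMonoidAlgebra K M) = single 0 (f.coeff a) * single a 1 := by
    rw [single_mul_single, zero_add, mul_one]
  rw [this]
  exact J.mul_mem_left _ (h a (hf a (Finsupp.mem_support_iff.1 ha)))

theorem IsProperFace.exists_notMem (hF : IsProperFace (cn M) F) : ∃ a ∈ M, toReal a ∉ F := by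
  by_contra! h
  refine hF.2 (Set.Subset.antisymm hF.1.subset ?_)
  rw [← hF.1.cn_interMonoid]
  exact cn_mono fun a ha ↦ hF.1.mem_interMonoid.2 ⟨ha, h a ha⟩

theorem facePrime_ne_bot (hF : IsProperFace (cn M) F) : facePrime K hF.1 ≠ ⊥ := by
  obtain ⟨a, ha, haF⟩ := hF.exists_notMem
  intro h
  have := (single_mem_facePrime (K := K) hF.1 (a := ⟨a, ha⟩)).2 haF
  rw [h, Ideal.mem_bot] at this
  simp at this

/-- The prime is minimal over any monomial `X^c` in it: for `a` off `G` and `b` in the relative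
interior of `G`, `X^c` divides a power of `X^a * X^b`, and `X^b` lies outside the prime. -/
theorem height_facePrime_le_one (hM : M.FG) (hG : IsFacet (cn M) G) :
    (facePrime K hG.isFace).height ≤ 1 := by
  have := isNoetherianRing_addMonoidAlgebra (K := K) hM
  obtain ⟨c, hc, hcG⟩ := hG.prop.exists_notMem
  refine Ideal.height_le_one_of_isPrincipal_of_mem_minimalPrimes
    (Ideal.span {(single ⟨c, hc⟩ 1 : AddMonoidAlgebra K M)}) _ ⟨⟨inferInstance, ?_⟩, ?_⟩
  · rw [Ideal.span_singleton_le_iff_mem]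
    exact (single_mem_facePrime hG.isFace).2 hcG
  rintro J ⟨hJ, hcJ⟩ hJG
  rw [Ideal.span_singleton_le_iff_mem] at hcJ
  refine facePrime_le _ fun a haG ↦ ?_
  obtain ⟨b, hb, hbG, hbr⟩ := hG.isFace.exists_mem_relint hM
  obtain ⟨k, hk⟩ := exists_forall_nsmul_add_mem hM
    (mem_gp_of_mem (add_mem a.2 hb)) (by
      rw [toReal_add]; exact hG.add_mem_relint_cn hM (toReal_mem_cn a.2) haG hbr)
    (neg_mem (mem_gp_of_mem hc))
  have hmem : (single a 1 : AddMonoidAlgebra K M) ^ k * single ⟨b, hb⟩ 1 ^ k ∈ J := by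
    have : (single a 1 : AddMonoidAlgebra K M) ^ k * single ⟨b, hb⟩ 1 ^ k =
        single ⟨c, hc⟩ 1 * single ⟨_, hk k le_rfl⟩ 1 := by
      rw [single_pow, single_pow, single_mul_single, single_mul_single]
      congr 1
      · ext1
        simp only [AddSubmonoid.coe_add, AddSubmonoidClass.coe_nsmul, smul_add]
        abel
      · simp
    rw [this]
    exact J.mul_mem_right _ hcJ
  refine hJ.mem_of_pow_mem k ((hJ.mem_or_mem hmem).resolve_right fun h ↦ ?_)
  exact (single_mem_facePrime hG.isFace).1 (hJG (hJ.mem_of_pow_mem k h)) hbG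

end FacePrime

theorem eq_prime_of_satisfiesS (hM : M.FG)
    (hS : Serre.SatisfiesS 2 (AddMonoidAlgebra K M) (AddMonoidAlgebra K M)) :
    (M : Set (Fin m → ℤ)) = prime M := by
  have := isNoetherianRing_addMonoidAlgebra (K := K) hM
  rw [Serre.satisfiesS_two_iff] at hS
  refine Set.Subset.antisymm (subset_prime M) fun x hx ↦ ?_
  obtain ⟨p, hp, q, hq, hpq⟩ := mem_gp_iff.1 hx.1
  by_contra hxM
  let X : M → AddMonoidAlgebra K M := fun a ↦ single a 1
  have hX : ∀ a b, X a * X b = X (a + b) := single_mul_single_one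
  have hdvd : ¬ X ⟨q, hq⟩ ∣ X ⟨p, hp⟩ := by
    rintro ⟨w, hw⟩
    have h1 : (toLaurent M K w).coeff x = 1 := by
      have : toLaurent M K w = single x 1 := by
        have h2 : (single q 1 : AddMonoidAlgebra K (Fin m → ℤ)) * toLaurent M K w =
            single q 1 * single x 1 := by
          rw [single_mul_single, one_mul, hpq, add_sub_cancel, ← toLaurent_single ⟨q, hq⟩,
            ← toLaurent_single ⟨p, hp⟩, ← map_mul]
          exact congrArg _ hw.symm
        exact mul_left_cancel₀ (single_ne_zero.2 one_ne_zero) h2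
      rw [this]; simp
    exact hxM (supportedIn_toLaurent w (S := (M : Set (Fin m → ℤ))) (fun a _ ↦ a.2) x
      (by rw [h1]; exact one_ne_zero))
  obtain ⟨Q, hQp, hQ, c, hc⟩ := Serre.exists_isPrime_forall_mem_iff_dvd hdvd
  have hXQ : X ⟨q, hq⟩ ∈ Q := hQ _ (dvd_mul_right _ _)
  have hht := hS (X ⟨q, hq⟩) c Q (by simp [X]) hc
  -- Primality of `Q` makes the exponents of monomials outside `Q` a submonoid with absorbing
  -- complement.
  obtain ⟨G, hG, hNG⟩ := exists_isFacet_of_forall_add_mem hM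
    (N := {n | ∃ h : n ∈ M, X ⟨n, h⟩ ∉ Q}) ⟨M.zero_mem, fun h ↦ hQp.one_notMem h⟩
    (fun a ha b hb ↦ by
      simp only [Set.mem_ofPred_eq, ha, hb, add_mem ha hb, exists_true_left]
      have : X ⟨a + b, add_mem ha hb⟩ = X ⟨a, ha⟩ * X ⟨b, hb⟩ := (hX ⟨a, ha⟩ ⟨b, hb⟩).symm
      rw [this, hQp.mul_mem_iff_mem_or_mem, not_or])
    ⟨q, hq, fun ⟨_, h⟩ ↦ h hXQ⟩
  obtain ⟨-, b, hb, hbG, hxb⟩ := hx.2 G hG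
  have hbQ : X ⟨b, hb⟩ ∈ Q := by
    refine hQ _ ⟨X ⟨x + b, hxb⟩, ?_⟩
    rw [hX, hX]
    congr 1
    ext1
    simp only [AddSubmonoid.coe_add, hpq]
    abel
  have hlt : facePrime K hG.isFace < Q := by
    refine lt_of_le_of_ne (facePrime_le _ fun a haG ↦ by_contra fun haQ ↦
      haG (hNG a a.2 ⟨a.2, haQ⟩)) ?_
    rintro rfl
    exact (single_mem_facePrime hG.isFace).1 hbQ hbG
  have h1 := Ideal.height_strict_mono_of_isPrime_of_isPrime hlt
  have h2 := Ideal.height_strict_mono_of_isPrime_of_isPrime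
    (bot_lt_iff_ne_bot.2 (facePrime_ne_bot (K := K) hG.prop))
  have h3 := h1.trans_le hht
  rw [Order.lt_one_iff] at h3
  simp [h3] at h2

theorem satisfiesS_of_eq_prime (hM : M.FG) (h : (M : Set (Fin m → ℤ)) = prime M) :
    Serre.SatisfiesS 2 (AddMonoidAlgebra K M) (AddMonoidAlgebra K M) := by
  have := isNoetherianRing_addMonoidAlgebra (K := K) hM
  have : IsDomain (AddMonoidAlgebra K (Fin m → ℤ)) := NoZeroDivisors.to_isDomain _
  rw [Serre.satisfiesS_two_iff]
  intro b c Q hQp hb hQ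
  by_contra! hht
  have hinj := toLaurent_injective (M := M) (K := K)
  have hQ0 : Q ≠ ⊥ := by rintro rfl; simp at hht
  -- Height above one makes `c / b` map `Q` into `Q`, hence also its extension to the integrally
  -- closed Laurent ring.
  have hdvd : toLaurent M K b ∣ toLaurent M K c := by
    refine Serre.dvd_of_forall_mem_ideal (J := Q.map (toLaurent M K))
      (Ideal.FG.map (IsNoetherian.noetherian Q) _) ?_ ((map_ne_zero_iff _ hinj).2 hb) fun q hq ↦ ?_
    · rwa [Ne, Ideal.map_eq_bot_iff_of_injective hinj]
    · induction hq using Submodule.span_induction with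
      | mem x hx =>
        obtain ⟨q, hq, rfl⟩ := hx
        obtain ⟨u, hu⟩ := (hQ q).1 hq
        exact ⟨_, Ideal.mem_map_of_mem _ (Serre.mem_of_mul_eq_mul_of_one_lt_height hb hQ hht hq hu),
          by rw [← map_mul, ← map_mul, hu]⟩
      | zero => exact ⟨0, zero_mem _, by simp⟩
      | add x y _ _ hx hy =>
        obtain ⟨u, hu, hxu⟩ := hx
        obtain ⟨v, hv, hyv⟩ := hy
        exact ⟨u + v, add_mem hu hv, by rw [add_mul, mul_add, hxu, hyv]⟩
      | smul a x _ hx =>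
        obtain ⟨u, hu, hxu⟩ := hx
        exact ⟨a * u, Ideal.mul_mem_left _ _ hu, by rw [smul_eq_mul, mul_assoc, hxu]; ring⟩
  obtain ⟨z, hz⟩ := hdvd
  have hgp : SupportedIn (gp M : Set (Fin m → ℤ)) z := by
    -- Weight zero suffices: translation by `gp M` preserves `gp M` and its complement.
    refine SupportedIn.of_mul 0 (H₀ := gp M) (H₁ := ∅) (h₁ := 0)
      ((map_ne_zero_iff (toLaurent M K) hinj).2 hb)
      (supportedIn_toLaurent b fun a _ ↦ mem_gp_of_mem a.2) (fun a ha ↦ absurd rfl ha)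
      (fun _ _ ↦ rfl) (fun _ h ↦ h.elim) (fun k hk s ↦ (gp M).add_mem_cancel_left hk)
      (fun _ h ↦ h.elim) ?_
    rw [add_zero, ← hz]
    exact supportedIn_toLaurent c fun a _ ↦ mem_gp_of_mem a.2
  have hfacet : ∀ G, IsFacet (cn M) G → SupportedIn (facetLoc M G) z := by
    intro G hG
    have hnot : ¬ Q ≤ facePrime K hG.isFace := fun hle ↦
      ((Ideal.height_mono hle).trans (height_facePrime_le_one hM hG)).not_gt hht
    obtain ⟨f, hfQ, hfG⟩ := SetLike.not_le_iff_exists.1 hnot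
    obtain ⟨u, hu⟩ := (hQ f).1 hfQ
    obtain ⟨β, hβ, hGβ⟩ := hG.isFace
    let w : (Fin m → ℤ) →+ ℝ :=
      { toFun a := β (toReal a)
        map_zero' := by rw [toReal_zero, map_zero]
        map_add' a b := by rw [toReal_add, map_add] }
    have hMG : ∀ k ∈ M, ∀ s ∈ facetLoc M G, k + s ∈ facetLoc M G := by
      rintro k hk s ⟨hs, b, hb, hbG, hsb⟩
      exact ⟨add_mem (mem_gp_of_mem hk) hs, b, hb, hbG, by rw [add_assoc]; exact add_mem hk hsb⟩
    have hmul : (toLaurent M K (faceProj K hG.isFace f) +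
        toLaurent M K (f - faceProj K hG.isFace f)) * z = toLaurent M K u := by
      rw [← map_add, add_sub_cancel]
      refine mul_left_cancel₀ ((map_ne_zero_iff (toLaurent M K) hinj).2 hb) ?_
      rw [mul_left_comm, ← hz, ← map_mul, ← map_mul, hu]
    classical
    -- The facet form is the weight: the part of `f` on `G` is nonzero of weight zero, and
    -- translation by `M ∩ G` preserves `M_G` and its complement.
    refine SupportedIn.of_mul w (h₀ := toLaurent M K (faceProj K hG.isFace f))
      (h₁ := toLaurent M K (f - faceProj K hG.isFace f)) (H₀ := {a | a ∈ M ∧ toReal a ∈ G})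
      (H₁ := {a | a ∈ M ∧ toReal a ∉ G}) ((map_ne_zero_iff (toLaurent M K) hinj).2 hfG)
      (supportedIn_toLaurent (faceProj K hG.isFace f) fun a ha ↦ ⟨a.2, ?_⟩)
      (supportedIn_toLaurent (f - faceProj K hG.isFace f) fun a ha ↦ ⟨a.2, ?_⟩)
      ?_ ?_ ?_ (fun k hk ↦ hMG k hk.1) ?_
    · rw [coeff_faceProj] at ha
      exact by_contra fun haG ↦ ha (if_neg haG)
    · intro haG
      rw [coeff_sub, Finsupp.sub_apply, coeff_faceProj, if_pos haG, sub_self] at ha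
      exact ha rfl
    · rintro k ⟨-, hk⟩
      rw [hGβ] at hk
      exact hk.2
    · rintro k ⟨hkM, hk⟩
      rw [hGβ] at hk
      exact lt_of_le_of_ne (hβ _ (toReal_mem_cn hkM)) fun h ↦ hk ⟨toReal_mem_cn hkM, h.symm⟩
    · rintro k ⟨hkM, hkG⟩ s
      refine ⟨fun ⟨hs, b, hb, hbG, hsb⟩ ↦ ⟨?_, k + b, add_mem hkM hb, ?_, ?_⟩, hMG k hkM s⟩
      · exact ((gp M).add_mem_cancel_left (mem_gp_of_mem hkM)).1 hs
      · rw [toReal_add]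
        exact (hG.isFace.add_mem_iff (toReal_mem_cn hkM) (toReal_mem_cn hb)).2 ⟨hkG, hbG⟩
      · rw [← add_assoc, add_comm s k]; exact hsb
    · rw [hmul]
      exact supportedIn_toLaurent u fun a _ ↦ (subset_prime M a.2).2 G hG
  obtain ⟨z, rfl⟩ := exists_toLaurent_eq (M := M) (z := z) fun a ha ↦ by
    rw [h]
    exact ⟨hgp a ha, fun G hG ↦ hfacet G hG a ha⟩
  exact hQp.one_notMem ((hQ 1).2 ⟨z, by rw [one_mul]; exact hinj (by rw [hz, map_mul])⟩)

theorem satisfiesS_iff_eq_prime (hM : M.FG) :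
    Serre.SatisfiesS 2 (AddMonoidAlgebra K M) (AddMonoidAlgebra K M) ↔
      (M : Set (Fin m → ℤ)) = prime M :=
  ⟨eq_prime_of_satisfiesS hM, satisfiesS_of_eq_prime hM⟩

end AffineMonoid

theorem corollary3p4 {m : ℕ} (M : AddSubmonoid (Fin m → ℤ)) (hM : M.FG)
    (K : Type*) [Field K] :
    (AffineMonoid.ContainsInterior M →
      List.TFAE [
        Serre.SatisfiesS 2 (AddMonoidAlgebra K M) (AddMonoidAlgebra K M),
        (M : Set (Fin m → ℤ)) = AffineMonoid.prime M,
        AffineMonoid.InteriorCondition M]) ∧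
    (AffineMonoid.IsSeminormal M →
      AffineMonoid.ContainsInterior M ∧
      List.TFAE [
        Serre.SatisfiesS 2 (AddMonoidAlgebra K M) (AddMonoidAlgebra K M),
        (M : Set (Fin m → ℤ)) = AffineMonoid.prime M,
        AffineMonoid.InteriorCondition M,
        AffineMonoid.GroupCondition M]) := by
  have h12 := AffineMonoid.satisfiesS_iff_eq_prime (K := K) hM
  refine ⟨fun hI ↦ ?_, fun hs ↦ ?_⟩
  · have h23 := AffineMonoid.eq_prime_iff_interiorCondition hM hI
    tfae_have 1 ↔ 2 := h12
    tfae_have 2 ↔ 3 := h23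
    tfae_finish
  · have hI := hs.containsInterior hM
    have h23 := AffineMonoid.eq_prime_iff_interiorCondition hM hI
    have h34 := AffineMonoid.interiorCondition_iff_groupCondition hM hs
    refine ⟨hI, ?_⟩
    tfae_have 1 ↔ 2 := h12
    tfae_have 2 ↔ 3 := h23
    tfae_have 3 ↔ 4 := h34
    tfae_finish
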